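/- **Notation.** For $a\in L^\infty(\mathbb T)$ with Fourier coefficients $a_n$, let $T(a)=(a_{j-k})_{j,k\ge0}$ and $H(a)=(a_{j+k+1})_{j,k\ge0}$ be the Toeplitz and Hankel operators on $\ell^2=\ell^2(\{0,1,2,\dots\})$, let $M(a,b)=T(a)+H(b)$, and let $\tilde a(e^{i\theta})=a(e^{-i\theta})$. Inverse operators are written $T^{-1}(a)=T(a)^{-1}$, $M^{-1}(a,b)=M(a,b)^{-1}$. Let $H^\infty_\pm=\{f\in L^\infty(\mathbb T): f_n=0 \text{ for all } \pm n<0\}$, and let $B_1^1$ be the Besov class of all $a\in L^1(\mathbb T)$ with $$\int_{-\pi}^{\pi}\frac1{y^2}\int_{-\pi}^{\pi}|a(e^{ix+iy})+a(e^{ix-iy})-2a(e^{ix})|\,dx\,dy<\infty$$ (such functions are identified with their continuous representatives). A *bounded factorization* of $f$ is $f=f_-f_+$ with $f_\pm,f_\pm^{-1}\in H^\infty_\pm$. An operator determinant $\det A$ is *well defined* if $A-I$ is trace class (and all inverses occurring in $A$ exist as bounded operators). For $A,B\in L^\infty(\mathbb T)$ with $T(A),T(B)$ invertible and $H(A)H(\tilde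 B)$ trace class put $$E[A,B]=\det\big(T^{-1}(A)\,T(AB)\,T^{-1}(B)\big),$$ and for nonvanishing $C\in B_1^1$ with winding number zero put $F[C]=\det\big(I+T^{-1}(C)H(C)\big)$. **Theorem.** Let $\psi,\phi\in L^\infty(\mathbb T)$ with $\phi\tilde\phi=1$ and with $T(\psi)$ invertible on $\ell^2$. Let $c\in B_1^1$ be nonvanishing with winding number zero, and let $d\in B_1^1$ have a factorization $d=d_+\tilde d_+^{-1}$ with $d_+,d_+^{-1}\in H^\infty_+\cap B_1^1$. (a) If $M(1,\phi)$ is invertible on $\ell^2$, then the operator determinant $$E_1=\det\Big(T^{-1}(cd_+)\,T^{-1}(\psi)\,M(c,cd\phi)\,T^{-1}(\psi^{-1})\,T(d_+)\,T(\psi^{-1})\,M^{-1}(1,\phi)\,T(\psi)\Big)$$ is well defined. (b) If $T(\phi)$ is invertible on $\ell^2$, then $M(1,\phi)$ is invertible, and $$E_1=\frac{E[\psi,cd_+]}{E[cd_+,\psi]}\cdot E[d_+^{-1},\psi^{-1}]\cdot E[cd_+,\phi]\cdot\det\Big(\big(T(cd_+\phi)+H(cd_+)\big)T^{-1}(cd_+\phi)\Big),$$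 where all the determinants are well defined and $E[cd_+,\psi]\neq0$. (c) If $\psi$ has a bounded factorization, and $\phi$ has a bounded factorization of the form $\phi=\phi_-\tilde\phi_-^{-1}$ with $\phi_-,\phi_-^{-1}\in H^\infty_-$, then $M(1,\phi)$ is invertible, and $$E_1=\frac{E[\psi,c]}{E[c,\psi]}\cdot E[cd_+,\phi]\cdot F[cd_+],$$ where all the determinants are well defined and $E[c,\psi]\neq0$. -/

import Mathlib

open MeasureTheory Filter Topology
open scoped ENNReal Real Ring

noncomputable section

namespace ToeplitzHankel

instance factTwoPiPos : Fact (0 < 2 * π) := ⟨Real.two_pi_pos⟩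

/-- The unit circle `𝕋`, parametrised by `x ↦ e^{ix}` with `x` modulo `2π`. -/
abbrev 𝕋 : Type := AddCircle (2 * π)

/-- Normalised Lebesgue measure on the circle. -/
abbrev haar : Measure 𝕋 := AddCircle.haarAddCircle

/-- The Hilbert space `ℓ²` of square summable complex sequences indexed by `0, 1, 2, …`. -/
abbrev Ell2 : Type := lp (fun _ : ℕ => ℂ) 2

/-- The standard basis vector `e_k` of `ℓ²`. -/
def stdVec (k : ℕ) : Ell2 := lp.single 2 k (1 : ℂ)

/-! ### Toeplitz and Hankel operators -/

/-- The reflected function `a~(e^{ix}) = a(e^{-ix})`. -/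
def tilde (a : 𝕋 → ℂ) : 𝕋 → ℂ := fun x => a (-x)

open Classical in
/-- Multiplication by `a ∈ L^∞(𝕋)` on `L²(𝕋)` (and `0` if `a` is not in `L^∞`). -/
def mulOp (a : 𝕋 → ℂ) : Lp ℂ 2 haar →L[ℂ] Lp ℂ 2 haar :=
  if ha : MemLp a ∞ haar then
    (ContinuousLinearMap.mul ℂ ℂ).holderL haar ∞ 2 2 (ha.toLp a)
  else 0

/-- The isometry `ℓ² → L²(𝕋)` with `e_k ↦ e^{ikx}`. -/
def embPlus : Ell2 →ₗᵢ[ℂ] Lp ℂ 2 haar :=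
  ((orthonormal_fourier (T := 2 * π)).comp (fun k : ℕ => (k : ℤ))
    (fun _ _ h => Int.ofNat.inj h)).orthogonalFamily.linearIsometry

/-- The isometry `ℓ² → L²(𝕋)` with `e_k ↦ e^{-i(k+1)x}`. -/
def embMinus : Ell2 →ₗᵢ[ℂ] Lp ℂ 2 haar :=
  ((orthonormal_fourier (T := 2 * π)).comp (fun k : ℕ => (-(k : ℤ) - 1))
    (fun _ _ h => by simpa using h)).orthogonalFamily.linearIsometry

/-- The Toeplitz operator `T(a)`, with matrix `(a_{j-k})_{j,k ≥ 0}`. -/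
def toeplitz (a : 𝕋 → ℂ) : Ell2 →L[ℂ] Ell2 :=
  (ContinuousLinearMap.adjoint embPlus.toContinuousLinearMap) ∘L mulOp a ∘L
    embPlus.toContinuousLinearMap

/-- The Hankel operator `H(a)`, with matrix `(a_{j+k+1})_{j,k ≥ 0}`. -/
def hankel (a : 𝕋 → ℂ) : Ell2 →L[ℂ] Ell2 :=
  (ContinuousLinearMap.adjoint embPlus.toContinuousLinearMap) ∘L mulOp a ∘L
    embMinus.toContinuousLinearMap

theorem embPlus_stdVec (k : ℕ) : embPlus (stdVec k) = fourierLp (T := 2 * π) 2 (k : ℤ) := by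
  rw [embPlus, stdVec, OrthogonalFamily.linearIsometry_apply_single]
  simp

theorem embMinus_stdVec (k : ℕ) :
    embMinus (stdVec k) = fourierLp (T := 2 * π) 2 (-(k : ℤ) - 1) := by
  rw [embMinus, stdVec, OrthogonalFamily.linearIsometry_apply_single]
  simp

theorem inner_mulOp_fourier {a : 𝕋 → ℂ} (ha : MemLp a ∞ haar) (m n : ℤ) :
    inner ℂ (fourierLp (T := 2 * π) 2 m) (mulOp a (fourierLp (T := 2 * π) 2 n)) =
      fourierCoeff a (m - n) := by
  rw [L2.inner_def, fourierCoeff, mulOp, dif_pos ha]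
  apply integral_congr_ae
  filter_upwards [coeFn_fourierLp (T := 2 * π) 2 m, coeFn_fourierLp (T := 2 * π) 2 n,
    ContinuousLinearMap.coeFn_holder (r := 2) (ContinuousLinearMap.mul ℂ ℂ) (ha.toLp a)
      (fourierLp (T := 2 * π) 2 n), ha.coeFn_toLp] with x h1 h2 h3 h4
  rw [ContinuousLinearMap.holderL_apply_apply, h3, h1, h2, h4]
  rw [show -(m - n) = n + -m by ring, fourier_add, fourier_neg]
  simp only [RCLike.inner_apply, ContinuousLinearMap.mul_apply', smul_eq_mul]
  ring

/-- The matrix of `T(a)` is `(a_{j-k})`. -/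
theorem inner_toeplitz {a : 𝕋 → ℂ} (ha : MemLp a ∞ haar) (j k : ℕ) :
    inner ℂ (stdVec j) (toeplitz a (stdVec k)) = fourierCoeff a ((j : ℤ) - k) := by
  rw [← inner_mulOp_fourier ha, ← embPlus_stdVec, ← embPlus_stdVec]
  simp only [toeplitz, ContinuousLinearMap.comp_apply, ContinuousLinearMap.adjoint_inner_right]
  rfl

/-- The matrix of `H(a)` is `(a_{j+k+1})`. -/
theorem inner_hankel {a : 𝕋 → ℂ} (ha : MemLp a ∞ haar) (j k : ℕ) :
    inner ℂ (stdVec j) (hankel a (stdVec k)) = fourierCoeff a ((j : ℤ) + k + 1) := by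
  rw [show (j : ℤ) + k + 1 = j - (-(k : ℤ) - 1) by ring,
    ← inner_mulOp_fourier ha, ← embPlus_stdVec, ← embMinus_stdVec]
  simp only [hankel, ContinuousLinearMap.comp_apply, ContinuousLinearMap.adjoint_inner_right]
  rfl

/-- `M(a,b) = T(a) + H(b)`. -/
def opM (a b : 𝕋 → ℂ) : Ell2 →L[ℂ] Ell2 := toeplitz a + hankel b

/-! ### Trace class operators and operator determinants -/

/-- Trace class (that is, nuclear) operators on `ℓ²`: sums `∑ ⟨v_n, ·⟩ u_n` of rank one operators
with `∑ ‖u_n‖ ‖v_n‖ < ∞`. -/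
def IsTraceClass (K : Ell2 →L[ℂ] Ell2) : Prop :=
  ∃ u v : ℕ → Ell2, Summable (fun n => ‖u n‖ * ‖v n‖) ∧
    HasSum (fun n => InnerProductSpace.rankOne ℂ (u n) (v n)) K

/-- The operator determinant of `A` is well defined: `A` is the identity plus a trace class
operator. -/
def HasOpDet (A : Ell2 →L[ℂ] Ell2) : Prop := IsTraceClass (A - 1)

/-- The matrix of the finite section `P_n A P_n`. -/
def finiteSection (A : Ell2 →L[ℂ] Ell2) (n : ℕ) : Matrix (Fin n) (Fin n) ℂ :=
  Matrix.of fun j k => inner ℂ (stdVec j) (A (stdVec k))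

/-- The operator (Fredholm) determinant `det A = lim_n det (P_n A P_n)`; the limit exists whenever
`A` is the identity plus a trace class operator, as the determinant is continuous in trace norm
and `P_n K P_n → K` in trace norm for trace class `K`. -/
def opDet (A : Ell2 →L[ℂ] Ell2) : ℂ :=
  limUnder atTop fun n => (finiteSection A n).det

/-! ### Function classes -/

/-- The Besov (semi)norm
`∫_{-π}^{π} y⁻² ∫_{-π}^{π} |a(e^{ix+iy}) + a(e^{ix-iy}) - 2 a(e^{ix})| dx dy`. -/
def besovNorm (a : 𝕋 → ℂ) : ℝ≥0∞ :=
  ∫⁻ y in Set.Ioo (-π) π, ENNReal.ofReal (1 / y ^ 2) *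
    ∫⁻ x in Set.Ioo (-π) π, ‖a ((x + y : ℝ) : 𝕋) + a ((x - y : ℝ) : 𝕋) - 2 * a (x : 𝕋)‖ₑ

/-- The Besov class `B₁¹`. -/
def MemB11 (a : 𝕋 → ℂ) : Prop := Integrable a haar ∧ besovNorm a < ∞

/-- The Hardy space `H^∞_+`. -/
def MemHPlus (f : 𝕋 → ℂ) : Prop := MemLp f ∞ haar ∧ ∀ n : ℤ, n < 0 → fourierCoeff f n = 0

/-- The Hardy space `H^∞_-`. -/
def MemHMinus (f : 𝕋 → ℂ) : Prop := MemLp f ∞ haar ∧ ∀ n : ℤ, 0 < n → fourierCoeff f n = 0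

/-- `f` and `f⁻¹` belong to `H^∞_+`. -/
def IsUnitHPlus (f : 𝕋 → ℂ) : Prop := (∀ᵐ x ∂haar, f x ≠ 0) ∧ MemHPlus f ∧ MemHPlus f⁻¹

/-- `f` and `f⁻¹` belong to `H^∞_-`. -/
def IsUnitHMinus (f : 𝕋 → ℂ) : Prop := (∀ᵐ x ∂haar, f x ≠ 0) ∧ MemHMinus f ∧ MemHMinus f⁻¹

/-- A bounded (canonical) factorization `f = f₋ f₊` exists. -/
def HasBoundedFactorization (f : 𝕋 → ℂ) : Prop :=
  ∃ fm fp : 𝕋 → ℂ, IsUnitHMinus fm ∧ IsUnitHPlus fp ∧ f =ᵐ[haar] fm * fp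

/-- A bounded factorization of the form `f = f₋ f₋~⁻¹` exists. -/
def HasAntisymmetricBoundedFactorization (f : 𝕋 → ℂ) : Prop :=
  ∃ fm : 𝕋 → ℂ, IsUnitHMinus fm ∧ f =ᵐ[haar] fm * (tilde fm)⁻¹

/-- The factorization `d = d₊ d₊~⁻¹` in `B₁¹`, with `d₊, d₊⁻¹ ∈ H^∞_+ ∩ B₁¹`. -/
def IsB11Factorization (d dp : 𝕋 → ℂ) : Prop :=
  IsUnitHPlus dp ∧ MemB11 dp ∧ MemB11 dp⁻¹ ∧ d =ᵐ[haar] dp * (tilde dp)⁻¹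

/-- The nonvanishing continuous function `c` on the circle has winding number `n` about `0`: a
continuous logarithm of `x ↦ c(e^{ix})` increases by `2πi n` over a period. -/
def HasWindingNumber (c : 𝕋 → ℂ) (n : ℤ) : Prop :=
  ∃ g : ℝ → ℂ, Continuous g ∧ (∀ x : ℝ, Complex.exp (g x) = c (x : 𝕋)) ∧
    g (2 * π) - g 0 = 2 * π * Complex.I * n

/-! ### The constants -/

/-- The constant `E[A,B] = det (T⁻¹(A) T(AB) T⁻¹(B))`. -/
def constE (A B : 𝕋 → ℂ) : ℂ :=
  opDet ((toeplitz A)⁻¹ʳ * toeplitz (A * B) * (toeplitz B)⁻¹ʳ)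

/-- The conditions under which `E[A,B]` is defined. -/
def EDefined (A B : 𝕋 → ℂ) : Prop :=
  MemLp A ∞ haar ∧ MemLp B ∞ haar ∧ IsUnit (toeplitz A) ∧ IsUnit (toeplitz B) ∧
    IsTraceClass (hankel A * hankel (tilde B))

/-- The constant `F[C] = det (I + T⁻¹(C) H(C))`. -/
def constF (C : 𝕋 → ℂ) : ℂ := opDet (1 + (toeplitz C)⁻¹ʳ * hankel C)

/-- The operator
`T⁻¹(c d₊) T⁻¹(ψ) M(c, cdφ) T⁻¹(ψ⁻¹) T(d₊) T(ψ⁻¹) M⁻¹(1,φ) T(ψ)`. -/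
def opE1 (ψ φ c d dp : 𝕋 → ℂ) : Ell2 →L[ℂ] Ell2 :=
  (toeplitz (c * dp))⁻¹ʳ * (toeplitz ψ)⁻¹ʳ * opM c (c * d * φ) * (toeplitz ψ⁻¹)⁻¹ʳ *
    toeplitz dp * toeplitz ψ⁻¹ * (opM 1 φ)⁻¹ʳ * toeplitz ψ

/-- The operator determinant `E₁`. -/
def constE1 (ψ φ c d dp : 𝕋 → ℂ) : ℂ := opDet (opE1 ψ φ c d dp)

/-- The determinant `E₁` is well defined: the symbols are bounded, all operators inverted in it are
invertible on `ℓ²`, and the operator is the identity plus a trace class operator. -/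
def E1Defined (ψ φ c d dp : 𝕋 → ℂ) : Prop :=
  (∀ᵐ x ∂haar, ψ x ≠ 0) ∧ MemLp ψ⁻¹ ∞ haar ∧ MemLp (c * dp) ∞ haar ∧
    MemLp (c * d * φ) ∞ haar ∧ IsUnit (toeplitz (c * dp)) ∧ IsUnit (toeplitz ψ) ∧
    IsUnit (toeplitz ψ⁻¹) ∧ IsUnit (opM 1 φ) ∧ HasOpDet (opE1 ψ φ c d dp)

end ToeplitzHankel

end

open ToeplitzHankel

/-!
Write `a = c d₊`. Everything follows from the two product rules
`T(fg) = T(f) T(g) + H(f) H(g~)` and `H(fg) = T(f) H(g) + H(f) T(g~)` (`toeplitz_mul`,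
`hankel_mul`), which come from splitting `L²(𝕋)` into nonnegative and negative frequencies, together
with three analytic facts.

* Operator determinants. For trace class `K` the determinants of the finite sections of `1 + K`
  converge (`HasOpDet.tendsto`), and the limit is multiplicative (`opDet_mul`) and invariant under
  similarity (`opDet_conj`). The key estimate is a Lipschitz bound in trace norm that is uniform in
  the size of the section (`NuclearLE.norm_det_add_sub_le`). It follows from the Schwarz lemma and
  the bound `|det M|² ≤ exp (tr M*M - n)`, and it reduces the claims to operators of finite rank,
  where the determinant is that of a finite matrix.
* Hankel operators with symbols in `B₁¹` are trace class (`FiniteBesov.isTraceClass_hankel`). Let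
  `Δ_y f` be the second difference. Up to a nonzero constant that does not depend on `n ≥ 1`, the
  Fourier coefficient `f_n` is the integral of `y⁻² (Δ_y f)(x) · y e^{-ny} e^{-inx}` over `y > 0` and
  `x ∈ 𝕋`. For `n = j + k + 1` the factor `y e^{-ny} e^{-inx}` is a product of a function of `j` and
  one of `k`, so the matrix of `H(f)` is an integral of rank one matrices.
* Invertibility. If `T(ψ)` is invertible then `ψ` is invertible in `L^∞`, `T(ψ⁻¹)` is invertible
  (`isUnit_toeplitz_inv`), and so is `T(ψc)` for continuous `c` with winding number zero
  (`HasWindingNumber.preservesInvertibility`): such a `c` is `e^G`, and a trigonometric polynomial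
  `p` close to `G` gives `c = e^{G-p} e^p` with `e^{G-p}` close to `1` and `e^p` a product of units
  of `H^∞_±`.

Since `M(c, cdφ) = M(a, aφ) T(d₊⁻¹)`, the operator in `E₁` is similar to a product of the commutators
of `T(ψ)` with `T(a)` and of `T(d₊)` with `T(ψ⁻¹)`, and of `T(a)⁻¹ M(a, aφ) M(1, φ)⁻¹`
(`opDet_opE1`). These differ from `1` by trace class operators. If `T(φ)` is invertible, then
`(1 - H(φ)) (1 + H(φ)) = T(φ) T(φ~)` shows that `M(1, φ)` is, and
`M(a, aφ) M(1, φ)⁻¹ = M(aφ, a) T(φ)⁻¹` (`opM_mul_swap`); the three determinants are then the factors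
of the formula for `E₁`. When `ψ = ψ₋ ψ₊`, the operator `T(ψ₊)` commutes with `T(d₊)`, and the
contributions of `d₊` to the factors involving `ψ` cancel (`GoodSymbols.constE_ratio_eq`). When
`φ = φ₋ φ₋~⁻¹`, conjugation by `T(φ₋)` removes `φ` from the last factor
(`GoodSymbols.opDet_eq_constF`).
-/

namespace ToeplitzHankel

/-! ### Algebra of Toeplitz and Hankel operators -/

theorem inner_stdVec_left (j : ℕ) (x : Ell2) : inner ℂ (stdVec j) x = x j := by
  rw [stdVec, lp.inner_single_left]
  simp

theorem inner_stdVec_right (x : Ell2) (j : ℕ) : inner ℂ x (stdVec j) = star (x j) := by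
  rw [← inner_conj_symm, inner_stdVec_left]
  rfl

theorem orthonormal_stdVec : Orthonormal ℂ stdVec := by
  rw [orthonormal_iff_ite]
  intro i j
  rw [inner_stdVec_left, stdVec, lp.single_apply]
  simp [Pi.single_apply]

theorem hasSum_smul_stdVec (x : Ell2) : HasSum (fun k => x k • stdVec k) x := by
  have h := lp.hasSum_single (E := fun _ : ℕ => ℂ) (p := 2) (by simp) x
  refine h.congr_fun fun k => ?_
  rw [stdVec, ← lp.single_smul]
  simp

/-- Bounded operators on `ℓ²` are determined by their matrices. -/
theorem ext_matrix {A B : Ell2 →L[ℂ] Ell2}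
    (h : ∀ j k, inner ℂ (stdVec j) (A (stdVec k)) = inner ℂ (stdVec j) (B (stdVec k))) :
    A = B := by
  ext x : 1
  have key : ∀ k, A (stdVec k) = B (stdVec k) := fun k => by
    ext j
    simpa only [inner_stdVec_left] using h j k
  have h1 := (hasSum_smul_stdVec x).mapL A
  have h2 := (hasSum_smul_stdVec x).mapL B
  simp only [map_smul, key] at h1 h2
  exact h1.unique h2

theorem memLp_tilde {a : 𝕋 → ℂ} (ha : MemLp a ∞ haar) : MemLp (tilde a) ∞ haar :=
  ha.comp_measurePreserving (Measure.measurePreserving_neg haar)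

theorem memLp_mul {a b : 𝕋 → ℂ} (ha : MemLp a ∞ haar) (hb : MemLp b ∞ haar) :
    MemLp (a * b) ∞ haar :=
  hb.mul ha

theorem memLp_one : MemLp (1 : 𝕋 → ℂ) ∞ haar := memLp_const 1

theorem tilde_ae {a b : 𝕋 → ℂ} (h : a =ᵐ[haar] b) : tilde a =ᵐ[haar] tilde b :=
  (Measure.measurePreserving_neg haar).quasiMeasurePreserving.ae_eq_comp h

theorem tilde_tilde (a : 𝕋 → ℂ) : tilde (tilde a) = a := by
  ext x; simp [tilde]

theorem tilde_mul (a b : 𝕋 → ℂ) : tilde (a * b) = tilde a * tilde b := rfl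

theorem tilde_inv (a : 𝕋 → ℂ) : tilde a⁻¹ = (tilde a)⁻¹ := rfl

theorem fourierCoeff_tilde (a : 𝕋 → ℂ) (n : ℤ) :
    fourierCoeff (tilde a) n = fourierCoeff a (-n) := by
  rw [fourierCoeff, fourierCoeff, ← integral_neg_eq_self]
  refine integral_congr_ae (Eventually.of_forall fun x => ?_)
  simp [tilde, fourier_apply]

theorem mulOp_coeFn {a : 𝕋 → ℂ} (ha : MemLp a ∞ haar) (f : Lp ℂ 2 haar) :
    mulOp a f =ᵐ[haar] fun x => a x * f x := by
  rw [mulOp, dif_pos ha, ContinuousLinearMap.holderL_apply_apply]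
  filter_upwards [ContinuousLinearMap.coeFn_holder (r := 2) (ContinuousLinearMap.mul ℂ ℂ)
    (ha.toLp a) f, ha.coeFn_toLp] with x h1 h2
  rw [h1, h2, ContinuousLinearMap.mul_apply']

theorem mulOp_congr {a b : 𝕋 → ℂ} (h : a =ᵐ[haar] b) : mulOp a = mulOp b := by
  unfold mulOp
  by_cases ha : MemLp a ∞ haar
  · have hb : MemLp b ∞ haar := (memLp_congr_ae h).1 ha
    rw [dif_pos ha, dif_pos hb, (MemLp.toLp_eq_toLp_iff ha hb).2 h]
  · have hb : ¬ MemLp b ∞ haar := fun hb => ha ((memLp_congr_ae h).2 hb)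
    rw [dif_neg ha, dif_neg hb]

theorem toeplitz_congr {a b : 𝕋 → ℂ} (h : a =ᵐ[haar] b) : toeplitz a = toeplitz b := by
  rw [toeplitz, mulOp_congr h, toeplitz]

theorem hankel_congr {a b : 𝕋 → ℂ} (h : a =ᵐ[haar] b) : hankel a = hankel b := by
  rw [hankel, mulOp_congr h, hankel]

theorem mulOp_mul {a b : 𝕋 → ℂ} (ha : MemLp a ∞ haar) (hb : MemLp b ∞ haar) :
    mulOp (a * b) = mulOp a ∘L mulOp b := by
  ext1 f
  apply Lp.ext
  filter_upwards [mulOp_coeFn (memLp_mul ha hb) f, mulOp_coeFn ha (mulOp b f),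
    mulOp_coeFn hb f] with x h1 h2 h3
  rw [ContinuousLinearMap.comp_apply, h1, h2, h3, Pi.mul_apply, mul_assoc]

theorem embPlus_coeFn_eq : (⇑embPlus.toContinuousLinearMap : Ell2 → Lp ℂ 2 haar) = embPlus := rfl

theorem embMinus_coeFn_eq :
    (⇑embMinus.toContinuousLinearMap : Ell2 → Lp ℂ 2 haar) = embMinus := rfl

/-- The nonnegative and the negative frequencies together exhaust `L²(𝕋)`. -/
theorem embPlus_add_embMinus :
    embPlus.toContinuousLinearMap ∘L (ContinuousLinearMap.adjoint embPlus.toContinuousLinearMap) +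
      embMinus.toContinuousLinearMap ∘L
        (ContinuousLinearMap.adjoint embMinus.toContinuousLinearMap) =
      ContinuousLinearMap.id ℂ (Lp ℂ 2 haar) := by
  have hdense : Dense (Submodule.span ℂ (Set.range (fourierLp (T := 2 * π) 2)) : Set
      (Lp ℂ 2 haar)) := by
    have := span_fourierLp_closure_eq_top (T := 2 * π) (p := 2) (by simp)
    exact Submodule.dense_iff_topologicalClosure_eq_top.2 this
  have orth : ∀ m n : ℤ, inner ℂ (fourierLp (T := 2 * π) 2 m) (fourierLp (T := 2 * π) 2 n) =
      if m = n then (1 : ℂ) else 0 := orthonormal_iff_ite.1 orthonormal_fourier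
  have hpp : ∀ k : ℕ, (ContinuousLinearMap.adjoint embPlus.toContinuousLinearMap)
      (fourierLp (T := 2 * π) 2 (k : ℤ)) = stdVec k := fun k => by
    ext j
    rw [← inner_stdVec_left, ← inner_stdVec_left, ContinuousLinearMap.adjoint_inner_right,
      embPlus_coeFn_eq, embPlus_stdVec, orth, orthonormal_iff_ite.1 orthonormal_stdVec]
    simp
  have hpm : ∀ k : ℕ, (ContinuousLinearMap.adjoint embPlus.toContinuousLinearMap)
      (fourierLp (T := 2 * π) 2 (-(k : ℤ) - 1)) = 0 := fun k => by
    ext j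
    rw [← inner_stdVec_left, ContinuousLinearMap.adjoint_inner_right,
      embPlus_coeFn_eq, embPlus_stdVec, orth, if_neg (by omega)]
    simp
  have hmm : ∀ k : ℕ, (ContinuousLinearMap.adjoint embMinus.toContinuousLinearMap)
      (fourierLp (T := 2 * π) 2 (-(k : ℤ) - 1)) = stdVec k := fun k => by
    ext j
    rw [← inner_stdVec_left, ← inner_stdVec_left, ContinuousLinearMap.adjoint_inner_right,
      embMinus_coeFn_eq, embMinus_stdVec, orth, orthonormal_iff_ite.1 orthonormal_stdVec]
    simp
  have hmp : ∀ k : ℕ, (ContinuousLinearMap.adjoint embMinus.toContinuousLinearMap)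
      (fourierLp (T := 2 * π) 2 (k : ℤ)) = 0 := fun k => by
    ext j
    rw [← inner_stdVec_left, ContinuousLinearMap.adjoint_inner_right,
      embMinus_coeFn_eq, embMinus_stdVec, orth, if_neg (by omega)]
    simp
  refine ContinuousLinearMap.ext_on hdense ?_
  rintro _ ⟨n, rfl⟩
  simp only [add_apply, ContinuousLinearMap.comp_apply,
    ContinuousLinearMap.id_apply, embPlus_coeFn_eq, embMinus_coeFn_eq]
  rcases le_or_gt 0 n with hn | hn
  · obtain ⟨k, rfl⟩ := Int.eq_ofNat_of_zero_le hn
    rw [hpp, hmp, embPlus_stdVec, map_zero, add_zero]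
  · obtain ⟨k, rfl⟩ : ∃ k : ℕ, n = -(k : ℤ) - 1 := ⟨(-n - 1).toNat, by omega⟩
    rw [hpm, hmm, embMinus_stdVec, map_zero, zero_add]

theorem adjoint_embMinus_mulOp_embPlus {a : 𝕋 → ℂ} (ha : MemLp a ∞ haar) :
    (ContinuousLinearMap.adjoint embMinus.toContinuousLinearMap) ∘L mulOp a ∘L
      embPlus.toContinuousLinearMap = hankel (tilde a) := by
  refine ext_matrix fun j k => ?_
  rw [inner_hankel (memLp_tilde ha), fourierCoeff_tilde]
  simp only [ContinuousLinearMap.comp_apply, ContinuousLinearMap.adjoint_inner_right]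
  rw [embPlus_coeFn_eq, embMinus_coeFn_eq, embPlus_stdVec, embMinus_stdVec,
    inner_mulOp_fourier ha]
  congr 1
  ring

theorem adjoint_embMinus_mulOp_embMinus {a : 𝕋 → ℂ} (ha : MemLp a ∞ haar) :
    (ContinuousLinearMap.adjoint embMinus.toContinuousLinearMap) ∘L mulOp a ∘L
      embMinus.toContinuousLinearMap = toeplitz (tilde a) := by
  refine ext_matrix fun j k => ?_
  rw [inner_toeplitz (memLp_tilde ha), fourierCoeff_tilde]
  simp only [ContinuousLinearMap.comp_apply, ContinuousLinearMap.adjoint_inner_right]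
  rw [embMinus_coeFn_eq, embMinus_stdVec, embMinus_stdVec, inner_mulOp_fourier ha]
  congr 1
  ring

/-- `T(ab) = T(a) T(b) + H(a) H(b~)`. -/
theorem toeplitz_mul {a b : 𝕋 → ℂ} (ha : MemLp a ∞ haar) (hb : MemLp b ∞ haar) :
    toeplitz (a * b) = toeplitz a * toeplitz b + hankel a * hankel (tilde b) := by
  rw [← adjoint_embMinus_mulOp_embPlus hb]
  ext1 x
  have := congrArg (fun F => F (mulOp b (embPlus x))) embPlus_add_embMinus
  simp only [add_apply, ContinuousLinearMap.comp_apply,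
    ContinuousLinearMap.id_apply] at this
  simp only [toeplitz, hankel, mulOp_mul ha hb, add_apply,
    mul_apply_eq_comp, ContinuousLinearMap.comp_apply, ← map_add]
  congr 2
  exact this.symm

/-- `H(ab) = T(a) H(b) + H(a) T(b~)`. -/
theorem hankel_mul {a b : 𝕋 → ℂ} (ha : MemLp a ∞ haar) (hb : MemLp b ∞ haar) :
    hankel (a * b) = toeplitz a * hankel b + hankel a * toeplitz (tilde b) := by
  rw [← adjoint_embMinus_mulOp_embMinus hb]
  ext1 x
  have := congrArg (fun F => F (mulOp b (embMinus x))) embPlus_add_embMinus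
  simp only [add_apply, ContinuousLinearMap.comp_apply,
    ContinuousLinearMap.id_apply] at this
  simp only [toeplitz, hankel, mulOp_mul ha hb, add_apply,
    mul_apply_eq_comp, ContinuousLinearMap.comp_apply, ← map_add]
  congr 2
  exact this.symm

theorem fourierCoeff_one (n : ℤ) : fourierCoeff (1 : 𝕋 → ℂ) n = if n = 0 then 1 else 0 := by
  have h := orthonormal_iff_ite.1 (orthonormal_fourier (T := 2 * π)) n 0
  have h2 := inner_mulOp_fourier memLp_one n 0
  rw [sub_zero] at h2
  rw [← h2, ← h]
  congr 1
  apply Lp.ext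
  filter_upwards [mulOp_coeFn memLp_one (fourierLp (T := 2 * π) 2 0)] with x hx
  rw [hx, Pi.one_apply, one_mul]

@[simp] theorem toeplitz_one : toeplitz 1 = 1 := by
  refine ext_matrix fun j k => ?_
  rw [inner_toeplitz memLp_one, fourierCoeff_one, one_apply_eq_self,
    orthonormal_iff_ite.1 orthonormal_stdVec]
  simp [sub_eq_zero]

/-- Hankel operators with symbol in `H^∞_-` vanish. -/
theorem MemHMinus.hankel_eq_zero {a : 𝕋 → ℂ} (ha : MemHMinus a) : hankel a = 0 := by
  refine ext_matrix fun j k => ?_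
  rw [inner_hankel ha.1, ha.2 _ (by omega)]
  simp

theorem MemHPlus.tilde {a : 𝕋 → ℂ} (ha : MemHPlus a) : MemHMinus (tilde a) :=
  ⟨memLp_tilde ha.1, fun n hn => by rw [fourierCoeff_tilde, ha.2 _ (by omega)]⟩

theorem MemHMinus.tilde {a : 𝕋 → ℂ} (ha : MemHMinus a) : MemHPlus (tilde a) :=
  ⟨memLp_tilde ha.1, fun n hn => by rw [fourierCoeff_tilde, ha.2 _ (by omega)]⟩

theorem memHMinus_one : MemHMinus 1 :=
  ⟨memLp_one, fun n hn => by rw [fourierCoeff_one, if_neg hn.ne']⟩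

@[simp] theorem hankel_one : hankel 1 = 0 := memHMinus_one.hankel_eq_zero

theorem toeplitz_mul_hPlus {a b : 𝕋 → ℂ} (ha : MemLp a ∞ haar) (hb : MemHPlus b) :
    toeplitz (a * b) = toeplitz a * toeplitz b := by
  rw [toeplitz_mul ha hb.1, hb.tilde.hankel_eq_zero, mul_zero, add_zero]

theorem toeplitz_hMinus_mul {a b : 𝕋 → ℂ} (ha : MemHMinus a) (hb : MemLp b ∞ haar) :
    toeplitz (a * b) = toeplitz a * toeplitz b := by
  rw [toeplitz_mul ha.1 hb, ha.hankel_eq_zero, zero_mul, add_zero]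

theorem hankel_hMinus_mul {a b : 𝕋 → ℂ} (ha : MemHMinus a) (hb : MemLp b ∞ haar) :
    hankel (a * b) = toeplitz a * hankel b := by
  rw [hankel_mul ha.1 hb, ha.hankel_eq_zero, zero_mul, add_zero]

theorem hankel_mul_hMinus {a b : 𝕋 → ℂ} (ha : MemLp a ∞ haar) (hb : MemHMinus b) :
    hankel (a * b) = hankel a * toeplitz (tilde b) := by
  rw [hankel_mul ha hb.1, hb.hankel_eq_zero, mul_zero, zero_add]

theorem mul_inv_ae {a : 𝕋 → ℂ} (h0 : ∀ᵐ x ∂haar, a x ≠ 0) : a * a⁻¹ =ᵐ[haar] 1 := by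
  filter_upwards [h0] with x hx
  simp [hx]

theorem IsUnitHPlus.mul_toeplitz_inv {a : 𝕋 → ℂ} (ha : IsUnitHPlus a) :
    toeplitz a * toeplitz a⁻¹ = 1 := by
  rw [← toeplitz_mul_hPlus ha.2.1.1 ha.2.2, toeplitz_congr (mul_inv_ae ha.1), toeplitz_one]

theorem IsUnitHPlus.toeplitz_inv_mul {a : 𝕋 → ℂ} (ha : IsUnitHPlus a) :
    toeplitz a⁻¹ * toeplitz a = 1 := by
  rw [← toeplitz_mul_hPlus ha.2.2.1 ha.2.1, mul_comm, toeplitz_congr (mul_inv_ae ha.1),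
    toeplitz_one]

theorem IsUnitHMinus.mul_toeplitz_inv {a : 𝕋 → ℂ} (ha : IsUnitHMinus a) :
    toeplitz a * toeplitz a⁻¹ = 1 := by
  rw [← toeplitz_hMinus_mul ha.2.1 ha.2.2.1, toeplitz_congr (mul_inv_ae ha.1), toeplitz_one]

theorem IsUnitHMinus.toeplitz_inv_mul {a : 𝕋 → ℂ} (ha : IsUnitHMinus a) :
    toeplitz a⁻¹ * toeplitz a = 1 := by
  rw [← toeplitz_hMinus_mul ha.2.2 ha.2.1.1, mul_comm, toeplitz_congr (mul_inv_ae ha.1),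
    toeplitz_one]

theorem IsUnitHPlus.isUnit_toeplitz {a : 𝕋 → ℂ} (ha : IsUnitHPlus a) : IsUnit (toeplitz a) :=
  isUnit_iff_exists.2 ⟨_, ha.mul_toeplitz_inv, ha.toeplitz_inv_mul⟩

theorem IsUnitHMinus.isUnit_toeplitz {a : 𝕋 → ℂ} (ha : IsUnitHMinus a) : IsUnit (toeplitz a) :=
  isUnit_iff_exists.2 ⟨_, ha.mul_toeplitz_inv, ha.toeplitz_inv_mul⟩

theorem IsUnitHPlus.inv {a : 𝕋 → ℂ} (ha : IsUnitHPlus a) : IsUnitHPlus a⁻¹ :=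
  ⟨ha.1.mono fun x hx => by simpa using hx, ha.2.2, by simpa using ha.2.1⟩

theorem IsUnitHMinus.inv {a : 𝕋 → ℂ} (ha : IsUnitHMinus a) : IsUnitHMinus a⁻¹ :=
  ⟨ha.1.mono fun x hx => by simpa using hx, ha.2.2, by simpa using ha.2.1⟩

theorem IsUnitHPlus.tilde {a : 𝕋 → ℂ} (ha : IsUnitHPlus a) : IsUnitHMinus (tilde a) :=
  ⟨(Measure.measurePreserving_neg haar).quasiMeasurePreserving.ae (p := fun x => a x ≠ 0) ha.1,
    ha.2.1.tilde, ha.2.2.tilde⟩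

theorem IsUnitHMinus.tilde {a : 𝕋 → ℂ} (ha : IsUnitHMinus a) : IsUnitHPlus (tilde a) :=
  ⟨(Measure.measurePreserving_neg haar).quasiMeasurePreserving.ae (p := fun x => a x ≠ 0) ha.1, ha.2.1.tilde,
    ha.2.2.tilde⟩

/-! ### Trace class operators -/

/-- `K` has a representation `∑ ⟨v_n, ·⟩ u_n` with `∑ ‖u_n‖ ‖v_n‖ ≤ r`; that is, up to attainment
of an infimum, the trace norm of `K` is at most `r`. -/
def NuclearLE (K : Ell2 →L[ℂ] Ell2) (r : ℝ) : Prop :=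
  ∃ u v : ℕ → Ell2, Summable (fun n => ‖u n‖ * ‖v n‖) ∧ ∑' n, ‖u n‖ * ‖v n‖ ≤ r ∧
    HasSum (fun n => InnerProductSpace.rankOne ℂ (u n) (v n)) K

theorem isTraceClass_iff_nuclearLE {K : Ell2 →L[ℂ] Ell2} :
    IsTraceClass K ↔ ∃ r, NuclearLE K r :=
  ⟨fun ⟨u, v, h1, h2⟩ => ⟨_, u, v, h1, le_rfl, h2⟩, fun ⟨_, u, v, h1, _, h2⟩ => ⟨u, v, h1, h2⟩⟩

theorem NuclearLE.isTraceClass {K : Ell2 →L[ℂ] Ell2} {r : ℝ} (h : NuclearLE K r) :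
    IsTraceClass K :=
  isTraceClass_iff_nuclearLE.2 ⟨r, h⟩

theorem NuclearLE.mono {K : Ell2 →L[ℂ] Ell2} {r s : ℝ} (h : NuclearLE K r) (hrs : r ≤ s) :
    NuclearLE K s := by
  obtain ⟨u, v, h1, h2, h3⟩ := h
  exact ⟨u, v, h1, h2.trans hrs, h3⟩

/-- Any index set may be used in the definition of the trace norm, as only countably many terms of
a summable family are nonzero. -/
theorem nuclearLE_of_hasSum {ι : Type*} {u v : ι → Ell2} {K : Ell2 →L[ℂ] Ell2}
    {r : ℝ} (hs : Summable fun i => ‖u i‖ * ‖v i‖) (hr : ∑' i, ‖u i‖ * ‖v i‖ ≤ r)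
    (hK : HasSum (fun i => InnerProductSpace.rankOne ℂ (u i) (v i)) K) : NuclearLE K r := by
  set s : Set ι := Function.support fun i => ‖u i‖ * ‖v i‖
  have hcount : Countable s := hs.countable_support.to_subtype
  obtain ⟨f, hf⟩ := exists_injective_nat s
  have hu : ∀ i, Function.extend f (fun i => u i) 0 (f i) = u i := hf.extend_apply _ 0
  have hv : ∀ i, Function.extend f (fun i => v i) 0 (f i) = v i := hf.extend_apply _ 0
  have hu0 : ∀ n, n ∉ Set.range f → Function.extend f (fun i => u i) 0 n = 0 := fun n hn =>
    Function.extend_apply' _ _ _ hn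
  have hsum : HasSum (fun n => ‖Function.extend f (fun i : s => u i) 0 n‖ *
      ‖Function.extend f (fun i : s => v i) 0 n‖) (∑' i, ‖u i‖ * ‖v i‖) := by
    rw [← hf.hasSum_iff fun n hn => by rw [hu0 n hn, norm_zero, zero_mul]]
    simp only [Function.comp_def, hu, hv]
    exact (hasSum_subtype_iff_of_support_subset (f := fun i => ‖u i‖ * ‖v i‖)
      subset_rfl).2 hs.hasSum
  refine ⟨Function.extend f (fun i => u i) 0, Function.extend f (fun i => v i) 0, hsum.summable,
    hsum.tsum_eq.trans_le hr, ?_⟩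
  rw [← hf.hasSum_iff fun n hn => by rw [hu0 n hn]; simp]
  simp only [Function.comp_def, hu, hv]
  refine (hasSum_subtype_iff_of_support_subset
    (f := fun i => InnerProductSpace.rankOne ℂ (u i) (v i)) fun i hi => ?_).2 hK
  rw [Function.mem_support, ← norm_ne_zero_iff, InnerProductSpace.norm_rankOne] at hi
  exact hi

theorem NuclearLE.add {K L : Ell2 →L[ℂ] Ell2} {r s : ℝ} (hK : NuclearLE K r)
    (hL : NuclearLE L s) : NuclearLE (K + L) (r + s) := by
  obtain ⟨u, v, h1, h2, h3⟩ := hK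
  obtain ⟨u', v', h1', h2', h3'⟩ := hL
  have hs : HasSum (fun i => ‖Sum.elim u u' i‖ * ‖Sum.elim v v' i‖)
      (∑' n, ‖u n‖ * ‖v n‖ + ∑' n, ‖u' n‖ * ‖v' n‖) :=
    HasSum.sum (f := fun i => ‖Sum.elim u u' i‖ * ‖Sum.elim v v' i‖) h1.hasSum h1'.hasSum
  have hop : HasSum (fun i => InnerProductSpace.rankOne ℂ (Sum.elim u u' i) (Sum.elim v v' i))
      (K + L) :=
    HasSum.sum (f := fun i => InnerProductSpace.rankOne ℂ (Sum.elim u u' i) (Sum.elim v v' i))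
      h3 h3'
  exact nuclearLE_of_hasSum hs.summable (hs.tsum_eq.trans_le (add_le_add h2 h2')) hop

theorem NuclearLE.mul_left {K : Ell2 →L[ℂ] Ell2} {r : ℝ} (hK : NuclearLE K r)
    (S : Ell2 →L[ℂ] Ell2) : NuclearLE (S * K) (‖S‖ * r) := by
  obtain ⟨u, v, h1, h2, h3⟩ := hK
  have hle : ∀ n, ‖S (u n)‖ * ‖v n‖ ≤ ‖S‖ * (‖u n‖ * ‖v n‖) := fun n => by
    rw [← mul_assoc]; gcongr; exact S.le_opNorm _
  have hs : Summable fun n => ‖S (u n)‖ * ‖v n‖ :=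
    Summable.of_nonneg_of_le (fun n => by positivity) hle (h1.mul_left _)
  refine ⟨fun n => S (u n), v, hs, ?_, ?_⟩
  · calc _ ≤ ∑' n, ‖S‖ * (‖u n‖ * ‖v n‖) := hs.tsum_le_tsum hle (h1.mul_left _)
      _ = ‖S‖ * ∑' n, ‖u n‖ * ‖v n‖ := tsum_mul_left
      _ ≤ _ := by gcongr
  · simpa only [ContinuousLinearMap.mul_def, InnerProductSpace.comp_rankOne] using h3.mul_left S

theorem NuclearLE.mul_right {K : Ell2 →L[ℂ] Ell2} {r : ℝ} (hK : NuclearLE K r)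
    (S : Ell2 →L[ℂ] Ell2) : NuclearLE (K * S) (r * ‖S‖) := by
  obtain ⟨u, v, h1, h2, h3⟩ := hK
  have hle : ∀ n, ‖u n‖ * ‖ContinuousLinearMap.adjoint S (v n)‖ ≤ (‖u n‖ * ‖v n‖) * ‖S‖ :=
    fun n => by
      rw [mul_assoc]
      gcongr
      refine ((ContinuousLinearMap.adjoint S).le_opNorm _).trans_eq ?_
      rw [LinearIsometryEquiv.norm_map, mul_comm]
  have hs : Summable fun n => ‖u n‖ * ‖ContinuousLinearMap.adjoint S (v n)‖ :=
    Summable.of_nonneg_of_le (fun n => by positivity) hle (h1.mul_right _)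
  refine ⟨u, fun n => ContinuousLinearMap.adjoint S (v n), hs, ?_, ?_⟩
  · calc _ ≤ ∑' n, (‖u n‖ * ‖v n‖) * ‖S‖ := hs.tsum_le_tsum hle (h1.mul_right _)
      _ = (∑' n, ‖u n‖ * ‖v n‖) * ‖S‖ := tsum_mul_right
      _ ≤ _ := by gcongr
  · simpa only [ContinuousLinearMap.mul_def, InnerProductSpace.rankOne_comp] using h3.mul_right S

theorem NuclearLE.nonneg {K : Ell2 →L[ℂ] Ell2} {r : ℝ} (hK : NuclearLE K r) : 0 ≤ r := by
  obtain ⟨u, v, h1, h2, h3⟩ := hK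
  exact (tsum_nonneg fun n => by positivity).trans h2

theorem NuclearLE.smul {K : Ell2 →L[ℂ] Ell2} {r : ℝ} (hK : NuclearLE K r) (z : ℂ) :
    NuclearLE (z • K) (‖z‖ * r) := by
  have h := hK.mul_left (z • 1)
  rw [smul_mul_assoc, one_mul] at h
  refine h.mono ?_
  have hr := hK.nonneg
  gcongr
  rw [norm_smul]
  exact mul_le_of_le_one_right (norm_nonneg _) ContinuousLinearMap.norm_id_le

theorem NuclearLE.norm_le {K : Ell2 →L[ℂ] Ell2} {r : ℝ} (hK : NuclearLE K r) : ‖K‖ ≤ r := by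
  obtain ⟨u, v, h1, h2, h3⟩ := hK
  rw [← h3.tsum_eq]
  refine (norm_tsum_le_tsum_norm (by simpa using h1)).trans ?_
  simpa using h2

theorem IsTraceClass.add {K L : Ell2 →L[ℂ] Ell2} (hK : IsTraceClass K) (hL : IsTraceClass L) :
    IsTraceClass (K + L) := by
  obtain ⟨r, hr⟩ := isTraceClass_iff_nuclearLE.1 hK
  obtain ⟨s, hs⟩ := isTraceClass_iff_nuclearLE.1 hL
  exact (hr.add hs).isTraceClass

theorem IsTraceClass.mul_left {K : Ell2 →L[ℂ] Ell2} (hK : IsTraceClass K)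
    (S : Ell2 →L[ℂ] Ell2) : IsTraceClass (S * K) := by
  obtain ⟨r, hr⟩ := isTraceClass_iff_nuclearLE.1 hK
  exact (hr.mul_left S).isTraceClass

theorem IsTraceClass.mul_right {K : Ell2 →L[ℂ] Ell2} (hK : IsTraceClass K)
    (S : Ell2 →L[ℂ] Ell2) : IsTraceClass (K * S) := by
  obtain ⟨r, hr⟩ := isTraceClass_iff_nuclearLE.1 hK
  exact (hr.mul_right S).isTraceClass

theorem IsTraceClass.neg {K : Ell2 →L[ℂ] Ell2} (hK : IsTraceClass K) : IsTraceClass (-K) := by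
  simpa using hK.mul_left (-1)

theorem IsTraceClass.sub {K L : Ell2 →L[ℂ] Ell2} (hK : IsTraceClass K) (hL : IsTraceClass L) :
    IsTraceClass (K - L) := by
  simpa only [sub_eq_add_neg] using hK.add hL.neg

theorem isTraceClass_zero : IsTraceClass 0 :=
  ⟨0, 0, by simp, by simp⟩

/-! ### Determinants of finite sections -/

theorem finiteSection_apply (A : Ell2 →L[ℂ] Ell2) (n : ℕ) (j k : Fin n) :
    finiteSection A n j k = inner ℂ (stdVec j) (A (stdVec k)) := rfl

theorem finiteSection_add (A B : Ell2 →L[ℂ] Ell2) (n : ℕ) :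
    finiteSection (A + B) n = finiteSection A n + finiteSection B n := by
  ext j k
  simp [finiteSection_apply]

theorem finiteSection_smul (z : ℂ) (A : Ell2 →L[ℂ] Ell2) (n : ℕ) :
    finiteSection (z • A) n = z • finiteSection A n := by
  ext j k
  simp [finiteSection_apply]

theorem finiteSection_one (n : ℕ) : finiteSection 1 n = 1 := by
  ext j k
  rw [finiteSection_apply, one_apply_eq_self, orthonormal_iff_ite.1 orthonormal_stdVec,
    Matrix.one_apply]
  simp [Fin.ext_iff]

theorem orthonormal_stdVec_fin (n : ℕ) : Orthonormal ℂ fun j : Fin n => stdVec j :=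
  orthonormal_stdVec.comp _ Fin.val_injective

/-- The trace of a finite section is bounded by the trace norm. -/
theorem NuclearLE.norm_trace_le {K : Ell2 →L[ℂ] Ell2} {r : ℝ} (hK : NuclearLE K r) (n : ℕ) :
    ‖(finiteSection K n).trace‖ ≤ r := by
  obtain ⟨u, v, h1, h2, h3⟩ := hK
  have hterm : ∀ j : Fin n, HasSum (fun i => inner ℂ (stdVec j) (u i) * inner ℂ (v i) (stdVec j))
      (finiteSection K n j j) := fun j => by
    have := (h3.mapL (ContinuousLinearMap.apply ℂ Ell2 (stdVec j))).mapL (innerSL ℂ (stdVec j))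
    refine this.congr_fun fun i => ?_
    simp [mul_comm]
  have hsum : HasSum (fun i => ∑ j : Fin n, inner ℂ (stdVec j) (u i) * inner ℂ (v i) (stdVec j))
      (finiteSection K n).trace := hasSum_sum fun j _ => hterm j
  have hle : ∀ i, ‖∑ j : Fin n, inner ℂ (stdVec j) (u i) * inner ℂ (v i) (stdVec j)‖ ≤
      ‖u i‖ * ‖v i‖ := fun i => by
    have hb1 := (orthonormal_stdVec_fin n).sum_inner_products_le (x := u i) (s := Finset.univ)
    have hb2 := (orthonormal_stdVec_fin n).sum_inner_products_le (x := v i) (s := Finset.univ)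
    calc _ ≤ ∑ j : Fin n, ‖inner ℂ (stdVec j) (u i)‖ * ‖inner ℂ (stdVec j) (v i)‖ := by
          refine (norm_sum_le _ _).trans_eq (Finset.sum_congr rfl fun j _ => ?_)
          rw [norm_mul, norm_inner_symm (v i)]
      _ ≤ √(∑ j : Fin n, ‖inner ℂ (stdVec j) (u i)‖ ^ 2) *
          √(∑ j : Fin n, ‖inner ℂ (stdVec j) (v i)‖ ^ 2) :=
        Real.sum_mul_le_sqrt_mul_sqrt _ _ _
      _ ≤ √(‖u i‖ ^ 2) * √(‖v i‖ ^ 2) := by gcongr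
      _ = _ := by rw [Real.sqrt_sq (norm_nonneg _), Real.sqrt_sq (norm_nonneg _)]
  rw [← hsum.tsum_eq]
  exact (tsum_of_norm_bounded h1.hasSum hle).trans h2

/-- The Hilbert–Schmidt norm of a finite section is bounded by the trace norm. -/
theorem NuclearLE.sum_sq_le {K : Ell2 →L[ℂ] Ell2} {r : ℝ} (hK : NuclearLE K r) (n : ℕ) :
    ∑ k, ∑ j, ‖finiteSection K n j k‖ ^ 2 ≤ r ^ 2 := by
  have h := (hK.mul_left (ContinuousLinearMap.adjoint K)).norm_trace_le n
  rw [LinearIsometryEquiv.norm_map] at h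
  have htr : (finiteSection (ContinuousLinearMap.adjoint K * K) n).trace =
      ((∑ k : Fin n, ‖K (stdVec k)‖ ^ 2 : ℝ) : ℂ) := by
    rw [Matrix.trace, Complex.ofReal_sum]
    refine Finset.sum_congr rfl fun k _ => ?_
    rw [Matrix.diag_apply, finiteSection_apply, mul_apply_eq_comp,
      ContinuousLinearMap.adjoint_inner_right, inner_self_eq_norm_sq_to_K]
    simp
  rw [htr, Complex.norm_real, Real.norm_of_nonneg (by positivity)] at h
  calc _ ≤ ∑ k : Fin n, ‖K (stdVec k)‖ ^ 2 := Finset.sum_le_sum fun k _ =>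
        (orthonormal_stdVec_fin n).sum_inner_products_le (x := K (stdVec k)) (s := Finset.univ)
    _ ≤ ‖K‖ * r := h
    _ ≤ r * r := by gcongr; exacts [hK.nonneg, hK.norm_le]
    _ = _ := (sq r).symm

open scoped ComplexOrder in
/-- The eigenvalues `λ` of `M*M` satisfy `λ ≤ exp (λ - 1)`, so their product `|det M|²` is bounded
in terms of their sum. -/
theorem norm_det_sq_le {n : ℕ} (M : Matrix (Fin n) (Fin n) ℂ) :
    ‖M.det‖ ^ 2 ≤ Real.exp ((M.conjTranspose * M).trace.re - n) := by
  have hH : (M.conjTranspose * M).PosSemidef := Matrix.posSemidef_conjTranspose_mul_self M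
  have h1 : ((‖M.det‖ ^ 2 : ℝ) : ℂ) = ((∏ i, hH.isHermitian.eigenvalues i : ℝ) : ℂ) := by
    have := hH.isHermitian.det_eq_prod_eigenvalues
    rw [Matrix.det_mul, Matrix.det_conjTranspose] at this
    rw [Complex.ofReal_prod, Complex.ofReal_pow, ← Complex.conj_mul']
    exact this
  have h2 : (M.conjTranspose * M).trace.re = ∑ i, hH.isHermitian.eigenvalues i := by
    rw [hH.isHermitian.trace_eq_sum_eigenvalues, Complex.re_sum]
    rfl
  rw [Complex.ofReal_inj] at h1
  rw [h1, h2]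
  calc _ ≤ ∏ i, Real.exp (hH.isHermitian.eigenvalues i - 1) :=
        Finset.prod_le_prod (fun i _ => hH.eigenvalues_nonneg i) fun i _ => by
          linarith [Real.add_one_le_exp (hH.isHermitian.eigenvalues i - 1)]
    _ = _ := by rw [← Real.exp_sum]; simp

theorem NuclearLE.norm_det_le {K : Ell2 →L[ℂ] Ell2} {r : ℝ} (hK : NuclearLE K r) (n : ℕ) :
    ‖(finiteSection (1 + K) n).det‖ ≤ Real.exp (r + r ^ 2) := by
  have h := norm_det_sq_le (finiteSection (1 + K) n)
  have htr : ((finiteSection (1 + K) n).conjTranspose * finiteSection (1 + K) n).trace.re - n =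
      2 * (finiteSection K n).trace.re + ∑ k, ∑ j, ‖finiteSection K n j k‖ ^ 2 := by
    rw [finiteSection_add, finiteSection_one]
    set X := finiteSection K n
    have hX : ((X.conjTranspose * X).trace).re = ∑ k, ∑ j, ‖X j k‖ ^ 2 := by
      rw [Matrix.trace, Complex.re_sum]
      refine Finset.sum_congr rfl fun k _ => ?_
      rw [Matrix.diag_apply, Matrix.mul_apply, Complex.re_sum]
      refine Finset.sum_congr rfl fun j _ => ?_
      rw [Matrix.conjTranspose_apply, ← Complex.normSq_eq_norm_sq, Complex.star_def,
        ← Complex.normSq_eq_conj_mul_self, Complex.ofReal_re]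
    rw [Matrix.conjTranspose_add, Matrix.conjTranspose_one, add_mul, mul_add, mul_add, one_mul,
      one_mul, mul_one, Matrix.trace_add, Matrix.trace_add, Matrix.trace_add, Matrix.trace_one,
      Matrix.trace_conjTranspose]
    simp only [Complex.add_re, hX, Complex.star_def, Complex.conj_re, Fintype.card_fin,
      Complex.natCast_re]
    ring
  rw [htr] at h
  have h1 := (Complex.re_le_norm _).trans (hK.norm_trace_le n)
  have h2 := hK.sum_sq_le n
  refine le_of_sq_le_sq ?_ (Real.exp_pos _).le
  rw [← Real.exp_nat_mul]
  refine h.trans (Real.exp_le_exp.2 ?_)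
  have := sq_nonneg r
  push_cast
  linarith

/-- The determinants of finite sections are Lipschitz in trace norm, uniformly in the size of the
section. -/
theorem NuclearLE.norm_det_add_sub_le {K L : Ell2 →L[ℂ] Ell2} {r δ : ℝ} (hK : NuclearLE K r)
    (hL : NuclearLE L δ) (h0 : 0 < δ) (h1 : δ < 1) (n : ℕ) :
    ‖(finiteSection (1 + K + L) n).det - (finiteSection (1 + K) n).det‖ ≤
      2 * Real.exp ((r + 1) + (r + 1) ^ 2) * δ := by
  set G := Real.exp ((r + 1) + (r + 1) ^ 2)
  -- the bound follows from the Schwarz lemma for `z ↦ det (1 + K + z L)` on the disc `|z| < 1 / δ`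
  let f : ℂ → ℂ := fun z => (finiteSection (1 + K) n + z • finiteSection L n).det
  have hf : ∀ z, f z = (finiteSection (1 + (K + z • L)) n).det := fun z => by
    rw [← add_assoc, finiteSection_add, finiteSection_smul]
  have hdiff : Differentiable ℂ f := by
    simp only [f, Matrix.det_apply, Matrix.add_apply, Matrix.smul_apply, smul_eq_mul]
    fun_prop
  have hbound : ∀ z ∈ Metric.ball (0 : ℂ) (1 / δ), ‖f z‖ ≤ G := fun z hz => by
    rw [hf]
    refine NuclearLE.norm_det_le ((hK.add (hL.smul z)).mono ?_) n
    rw [mem_ball_zero_iff, lt_div_iff₀ h0] at hz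
    linarith
  have hz0 : (0 : ℂ) ∈ Metric.ball (0 : ℂ) (1 / δ) := Metric.mem_ball_self (by positivity)
  have := Complex.dist_le_div_mul_dist_of_mapsTo_ball (f := f) (c := 0) (z := 1) (R₁ := 1 / δ)
    (R₂ := 2 * G) hdiff.differentiableOn (fun z hz => by
      rw [Metric.mem_closedBall, dist_eq_norm]
      linarith [norm_sub_le (f z) (f 0), hbound z hz, hbound 0 hz0]) (by
      rw [mem_ball_zero_iff, norm_one, lt_div_iff₀ h0]; linarith)
  rw [dist_eq_norm, dist_eq_norm, hf 1, hf 0] at this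
  simpa [add_assoc] using this

/-- The partial sums of a trace class series converge in trace norm. -/
theorem exists_partialSum_approx {u v : ℕ → Ell2} {K : Ell2 →L[ℂ] Ell2}
    (h1 : Summable fun n => ‖u n‖ * ‖v n‖)
    (h2 : HasSum (fun n => InnerProductSpace.rankOne ℂ (u n) (v n)) K) :
    ∃ δ : ℕ → ℝ, Tendsto δ atTop (𝓝 0) ∧ ∀ m, NuclearLE
      (K - ∑ i ∈ Finset.range m, InnerProductSpace.rankOne ℂ (u i) (v i)) (δ m) := by
  refine ⟨fun m => ∑' i, ‖u (i + m)‖ * ‖v (i + m)‖,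
    tendsto_sum_nat_add fun i => ‖u i‖ * ‖v i‖, fun m => ⟨fun i => u (i + m), fun i => v (i + m),
      (summable_nat_add_iff m).2 h1, le_rfl, ?_⟩⟩
  exact (hasSum_nat_add_iff' m).2 h2

/-- The determinant of the identity plus an operator of finite rank is the determinant of a finite
matrix. -/
theorem tendsto_det_finiteRank (u v : ℕ → Ell2) (m : ℕ) :
    Tendsto (fun n => (finiteSection
      (1 + ∑ i ∈ Finset.range m, InnerProductSpace.rankOne ℂ (u i) (v i)) n).det) atTop
      (𝓝 (1 + Matrix.of fun i l : Fin m => (inner ℂ (v i) (u l) : ℂ)).det) := by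
  have hn : ∀ n, (finiteSection
      (1 + ∑ i ∈ Finset.range m, InnerProductSpace.rankOne ℂ (u i) (v i)) n).det =
      (1 + Matrix.of fun i l : Fin m => ∑ j ∈ Finset.range n, star (v i j) * u l j).det := by
    intro n
    let U : Matrix (Fin n) (Fin m) ℂ := Matrix.of fun j i => u i j
    let V : Matrix (Fin m) (Fin n) ℂ := Matrix.of fun i j => star (v i j)
    have e1 : finiteSection (1 + ∑ i ∈ Finset.range m,
        InnerProductSpace.rankOne ℂ (u i) (v i)) n = 1 + U * V := by
      rw [finiteSection_add, finiteSection_one]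
      congr 1
      ext j k
      rw [finiteSection_apply, Matrix.mul_apply, ← Fin.sum_univ_eq_sum_range
        (fun i => InnerProductSpace.rankOne ℂ (u i) (v i)), sum_apply,
        inner_sum]
      refine Finset.sum_congr rfl fun i _ => ?_
      rw [InnerProductSpace.rankOne_apply, inner_smul_right, inner_stdVec_left,
        inner_stdVec_right, mul_comm]
      rfl
    have e2 : V * U = Matrix.of fun i l : Fin m =>
        ∑ j ∈ Finset.range n, star (v i j) * u l j := by
      ext i l
      rw [Matrix.mul_apply, Matrix.of_apply,
        ← Fin.sum_univ_eq_sum_range (fun j => star (v i j) * u l j)]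
      rfl
    rw [e1, Matrix.det_one_add_mul_comm, e2]
  simp only [hn]
  have hcont : Continuous fun M : Matrix (Fin m) (Fin m) ℂ => (1 + M).det :=
    (continuous_const.add continuous_id).matrix_det
  refine (hcont.tendsto _).comp ?_
  refine tendsto_pi_nhds.2 fun i => tendsto_pi_nhds.2 fun l => ?_
  have h := (lp.hasSum_inner (𝕜 := ℂ) (v i) (u l)).tendsto_sum_nat
  refine h.congr fun n => ?_
  refine Finset.sum_congr rfl fun j _ => ?_
  rw [RCLike.inner_apply, mul_comm]
  rfl

/-! ### The operator determinant -/

/-- A sequence that is a uniform limit of convergent sequences is Cauchy. -/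
theorem cauchySeq_of_approx {x : ℕ → ℂ} {y : ℕ → ℕ → ℂ} {ε : ℕ → ℝ} {l : ℕ → ℂ}
    (hε : Tendsto ε atTop (𝓝 0)) (hy : ∀ m, Tendsto (y m) atTop (𝓝 (l m)))
    (h : ∀ᶠ m in atTop, ∀ n, ‖x n - y m n‖ ≤ ε m) : CauchySeq x := by
  rw [Metric.cauchySeq_iff]
  intro e he
  obtain ⟨m, hm, hmε⟩ := (h.and (hε.eventually_lt_const (show (0 : ℝ) < e / 3 by positivity))).exists
  obtain ⟨N, hN⟩ := Metric.cauchySeq_iff.1 (hy m).cauchySeq (e / 3) (by positivity)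
  refine ⟨N, fun a ha b hb => ?_⟩
  have h1 := hm a
  have h2 := hm b
  have h3 := hN a ha b hb
  rw [← dist_eq_norm] at h1 h2
  rw [dist_comm] at h2
  linarith [dist_triangle (x a) (y m a) (x b), dist_triangle (y m a) (y m b) (x b)]

/-- A null sequence of trace norm bounds may be taken positive. -/
theorem exists_pos_bound {δ : ℕ → ℝ} (hδ : Tendsto δ atTop (𝓝 0)) :
    ∃ ε : ℕ → ℝ, Tendsto ε atTop (𝓝 0) ∧ (∀ m, 0 < ε m) ∧ ∀ m, δ m ≤ ε m := by
  refine ⟨fun m => |δ m| + 1 / ((m : ℝ) + 1), ?_, fun m => by positivity, fun m => ?_⟩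
  · simpa using hδ.abs.add tendsto_one_div_add_atTop_nhds_zero_nat
  · have : 0 < 1 / ((m : ℝ) + 1) := by positivity
    linarith [le_abs_self (δ m)]

theorem HasOpDet.exists_eq {A : Ell2 →L[ℂ] Ell2} (hA : HasOpDet A) :
    ∃ K r, NuclearLE K r ∧ A = 1 + K := by
  obtain ⟨r, hr⟩ := isTraceClass_iff_nuclearLE.1 hA
  exact ⟨A - 1, r, hr, by abel⟩

theorem hasOpDet_one_add {K : Ell2 →L[ℂ] Ell2} (hK : IsTraceClass K) : HasOpDet (1 + K) := by
  rwa [HasOpDet, add_sub_cancel_left]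

/-- The limit defining the operator determinant exists. -/
theorem HasOpDet.tendsto {A : Ell2 →L[ℂ] Ell2} (hA : HasOpDet A) :
    Tendsto (fun n => (finiteSection A n).det) atTop (𝓝 (opDet A)) := by
  obtain ⟨u, v, h1, h2⟩ := id hA
  obtain ⟨r, hr⟩ := isTraceClass_iff_nuclearLE.1 hA
  obtain ⟨δ, hδ, happ⟩ := exists_partialSum_approx h1 h2
  obtain ⟨ε, hε, hpos, hle⟩ := exists_pos_bound hδ
  have hlim := hε.const_mul (2 * Real.exp ((r + 1) + (r + 1) ^ 2))
  rw [mul_zero] at hlim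
  have hc : CauchySeq fun n => (finiteSection A n).det := by
    refine cauchySeq_of_approx hlim (fun m => tendsto_det_finiteRank u v m) ?_
    filter_upwards [hε.eventually_lt_const zero_lt_one] with m hm n
    have hneg := ((happ m).mono (hle m)).smul (-1)
    rw [norm_neg, norm_one, one_mul, neg_one_smul, neg_sub] at hneg
    have := hr.norm_det_add_sub_le hneg (hpos m) hm n
    rw [add_sub_cancel, add_sub, add_sub_right_comm, sub_sub_cancel, norm_sub_rev] at this
    exact this
  exact CauchySeq.tendsto_limUnder hc

theorem opDet_eq_of_tendsto {A : Ell2 →L[ℂ] Ell2} {d : ℂ}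
    (h : Tendsto (fun n => (finiteSection A n).det) atTop (𝓝 d)) : opDet A = d :=
  h.limUnder_eq

@[simp] theorem opDet_one : opDet 1 = 1 :=
  opDet_eq_of_tendsto (by simp [finiteSection_one])

/-- The operator determinant is continuous in trace norm. -/
theorem tendsto_opDet_of_nuclearLE {A : Ell2 →L[ℂ] Ell2} (hA : HasOpDet A)
    {B : ℕ → Ell2 →L[ℂ] Ell2} {δ : ℕ → ℝ} (hδ : Tendsto δ atTop (𝓝 0))
    (hB : ∀ m, NuclearLE (B m - A) (δ m)) :
    Tendsto (fun m => opDet (B m)) atTop (𝓝 (opDet A)) := by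
  obtain ⟨K, r, hr, rfl⟩ := hA.exists_eq
  obtain ⟨ε, hε, hpos, hle⟩ := exists_pos_bound hδ
  have hlim := hε.const_mul (2 * Real.exp ((r + 1) + (r + 1) ^ 2))
  rw [mul_zero] at hlim
  rw [tendsto_iff_norm_sub_tendsto_zero]
  refine squeeze_zero' (Eventually.of_forall fun _ => norm_nonneg _) ?_ hlim
  filter_upwards [hε.eventually_lt_const zero_lt_one] with m hm
  have hBm : HasOpDet (B m) := by
    have := (hB m).isTraceClass.add hr.isTraceClass
    rw [HasOpDet]
    convert this using 1
    abel
  refine le_of_tendsto (hBm.tendsto.sub hA.tendsto).norm (Eventually.of_forall fun n => ?_)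
  have := hr.norm_det_add_sub_le ((hB m).mono (hle m)) (hpos m) hm n
  rwa [add_sub_cancel] at this

theorem HasOpDet.mul {A B : Ell2 →L[ℂ] Ell2} (hA : HasOpDet A) (hB : HasOpDet B) :
    HasOpDet (A * B) := by
  have := (IsTraceClass.mul_right hA B).add hB
  rw [HasOpDet]
  convert this using 1
  rw [sub_mul, one_mul]
  abel

theorem HasOpDet.conj {A S S' : Ell2 →L[ℂ] Ell2} (hA : HasOpDet A) (h : S * S' = 1) :
    HasOpDet (S * A * S') := by
  have := (IsTraceClass.mul_left hA S).mul_right S'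
  rw [HasOpDet]
  convert this using 1
  rw [mul_sub, sub_mul, mul_one, h]

/-- The orthogonal projection of `ℓ²` onto the span of `e_0, …, e_{n-1}`. -/
noncomputable def truncation (n : ℕ) : Ell2 →L[ℂ] Ell2 :=
  ∑ k ∈ Finset.range n, InnerProductSpace.rankOne ℂ (stdVec k) (stdVec k)

theorem truncation_apply (n : ℕ) (x : Ell2) :
    truncation n x = ∑ k ∈ Finset.range n, x k • stdVec k := by
  simp [truncation, inner_stdVec_left]

theorem truncation_apply_apply_of_le {n j : ℕ} (h : n ≤ j) (x : Ell2) : truncation n x j = 0 := by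
  rw [← inner_stdVec_left, truncation_apply, inner_sum]
  refine Finset.sum_eq_zero fun k hk => ?_
  rw [inner_smul_right, orthonormal_iff_ite.1 orthonormal_stdVec, if_neg, mul_zero]
  have := Finset.mem_range.1 hk
  omega

theorem tendsto_truncation (x : Ell2) : Tendsto (fun n => truncation n x) atTop (𝓝 x) := by
  simpa only [truncation_apply] using (hasSum_smul_stdVec x).tendsto_sum_nat

theorem norm_truncation_sub_le (n : ℕ) (x : Ell2) : ‖truncation n x - x‖ ≤ 2 * ‖x‖ := by
  have h : ‖truncation n x‖ ≤ ‖x‖ := by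
    refine le_of_sq_le_sq ?_ (norm_nonneg x)
    have h1 := orthonormal_stdVec.sum_inner_products_le (x := x) (s := Finset.range n)
    refine le_trans (le_of_eq ?_) h1
    rw [truncation_apply, ← Complex.ofReal_inj, Complex.ofReal_pow]
    have h2 := orthonormal_stdVec.inner_sum (fun k => x k) (fun k => x k) (Finset.range n)
    rw [inner_self_eq_norm_sq_to_K] at h2
    refine h2.trans ?_
    rw [Complex.ofReal_sum]
    refine Finset.sum_congr rfl fun k _ => ?_
    rw [inner_stdVec_left, Complex.conj_mul', Complex.ofReal_pow]
  linarith [norm_sub_le (truncation n x) x]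

theorem NuclearLE.exists_truncation_approx {K : Ell2 →L[ℂ] Ell2} {r : ℝ} (hK : NuclearLE K r) :
    ∃ δ : ℕ → ℝ, Tendsto δ atTop (𝓝 0) ∧ ∀ m, NuclearLE (truncation m * K - K) (δ m) := by
  obtain ⟨u, v, h1, -, h3⟩ := hK
  have hle : ∀ m i, ‖truncation m (u i) - u i‖ * ‖v i‖ ≤ 2 * (‖u i‖ * ‖v i‖) := fun m i => by
    rw [← mul_assoc]; gcongr; exact norm_truncation_sub_le _ _
  refine ⟨fun m => ∑' i, ‖truncation m (u i) - u i‖ * ‖v i‖, ?_, fun m =>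
    ⟨fun i => truncation m (u i) - u i, v, ?_, le_rfl, ?_⟩⟩
  · have := tendsto_tsum_of_dominated_convergence (𝓕 := atTop)
      (f := fun m i => ‖truncation m (u i) - u i‖ * ‖v i‖) (g := fun _ => (0 : ℝ))
      (h1.mul_left 2) (fun i => ?_) (Eventually.of_forall fun m i => ?_)
    · simpa using this
    · have := ((tendsto_truncation (u i)).sub_const (u i)).norm.mul_const ‖v i‖
      simpa using this
    · rw [Real.norm_of_nonneg (by positivity)]
      exact hle m i
  · exact Summable.of_nonneg_of_le (fun i => by positivity) (hle m) (h1.mul_left 2)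
  · have := (h3.mul_left (truncation m)).sub h3
    refine this.congr_fun fun i => ?_
    rw [ContinuousLinearMap.mul_def, InnerProductSpace.comp_rankOne, map_sub, sub_apply]

/-- Finite sections are multiplicative if the right factor leaves the span of `e_0, …, e_{n-1}`
invariant. -/
theorem finiteSection_mul {A B : Ell2 →L[ℂ] Ell2} {n : ℕ}
    (h : ∀ k < n, ∀ j, n ≤ j → B (stdVec k) j = 0) :
    finiteSection (A * B) n = finiteSection A n * finiteSection B n := by
  ext j k
  rw [Matrix.mul_apply, finiteSection_apply, mul_apply_eq_comp]
  have h1 := ((hasSum_smul_stdVec (B (stdVec k))).mapL A).mapL (innerSL ℂ (stdVec j))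
  have h2 : HasSum (fun l => inner ℂ (stdVec j) (A (stdVec l)) * (B (stdVec k)) l)
      (inner ℂ (stdVec j) (A (B (stdVec k)))) := by
    refine h1.congr_fun fun l => ?_
    simp [mul_comm]
  rw [← h2.tsum_eq, tsum_eq_sum (s := Finset.range n) (fun l hl => by
    rw [h k k.2 l (by simpa using hl), mul_zero]), ← Fin.sum_univ_eq_sum_range
    (fun l => inner ℂ (stdVec j) (A (stdVec l)) * (B (stdVec k)) l)]
  refine Finset.sum_congr rfl fun l _ => ?_
  rw [finiteSection_apply, finiteSection_apply, inner_stdVec_left l]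

/-- Operator determinants are multiplicative. -/
theorem opDet_mul {A B : Ell2 →L[ℂ] Ell2} (hA : HasOpDet A) (hB : HasOpDet B) :
    opDet (A * B) = opDet A * opDet B := by
  obtain ⟨L, r, hr, rfl⟩ := hB.exists_eq
  obtain ⟨δ, hδ, happ⟩ := hr.exists_truncation_approx
  -- `1 + P_m L` leaves the range of `P_n` invariant for `n ≥ m`, so its sections are multiplicative
  have hBm : ∀ m, HasOpDet (1 + truncation m * L) := fun m =>
    hasOpDet_one_add (hr.isTraceClass.mul_left _)
  have hmul : ∀ m, opDet (A * (1 + truncation m * L)) = opDet A * opDet (1 + truncation m * L) := by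
    intro m
    refine opDet_eq_of_tendsto ((hA.tendsto.mul (hBm m).tendsto).congr' ?_)
    filter_upwards [eventually_ge_atTop m] with n hn
    rw [finiteSection_mul, Matrix.det_mul]
    intro k hk j hj
    rw [add_apply, one_apply_eq_self, mul_apply_eq_comp, lp.coeFn_add, Pi.add_apply,
      truncation_apply_apply_of_le (hn.trans hj), ← inner_stdVec_left,
      orthonormal_iff_ite.1 orthonormal_stdVec, if_neg (by omega), add_zero]
  have h1 : Tendsto (fun m => opDet (1 + truncation m * L)) atTop (𝓝 (opDet (1 + L))) :=
    tendsto_opDet_of_nuclearLE hB hδ fun m => by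
      rw [add_sub_add_left_eq_sub]; exact happ m
  have h2 : Tendsto (fun m => opDet (A * (1 + truncation m * L))) atTop
      (𝓝 (opDet (A * (1 + L)))) := by
    have hδ' := hδ.const_mul ‖A‖
    rw [mul_zero] at hδ'
    refine tendsto_opDet_of_nuclearLE (hA.mul hB) hδ' fun m => ?_
    rw [← mul_sub, add_sub_add_left_eq_sub]
    exact (happ m).mul_left A
  simp only [hmul] at h2
  exact tendsto_nhds_unique h2 (h1.const_mul _)

/-- Operator determinants are invariant under similarity. -/
theorem opDet_conj {A S S' : Ell2 →L[ℂ] Ell2} (hA : HasOpDet A) (h : S * S' = 1)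
    (h' : S' * S = 1) : opDet (S * A * S') = opDet A := by
  obtain ⟨u, v, h1, h2⟩ := id hA
  obtain ⟨δ, hδ, happ⟩ := exists_partialSum_approx h1 h2
  let F : ℕ → Ell2 →L[ℂ] Ell2 := fun m =>
    ∑ i ∈ Finset.range m, InnerProductSpace.rankOne ℂ (u i) (v i)
  have hneg : ∀ m, NuclearLE (F m - (A - 1)) (δ m) := fun m => by
    simpa using (happ m).smul (-1)
  have hSF : ∀ m, S * F m * S' = ∑ i ∈ Finset.range m, InnerProductSpace.rankOne ℂ (S (u i))
      (ContinuousLinearMap.adjoint S' (v i)) := fun m => by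
    simp only [F, Finset.mul_sum, Finset.sum_mul, ContinuousLinearMap.mul_def,
      InnerProductSpace.comp_rankOne, InnerProductSpace.rankOne_comp]
  have heq : ∀ m, opDet (1 + S * F m * S') = opDet (1 + F m) := fun m => by
    rw [hSF, opDet_eq_of_tendsto (tendsto_det_finiteRank _ _ m),
      opDet_eq_of_tendsto (tendsto_det_finiteRank u v m)]
    congr 3
    ext i l
    rw [ContinuousLinearMap.adjoint_inner_left, ← mul_apply_eq_comp, h', one_apply_eq_self]
  have l1 : Tendsto (fun m => opDet (1 + F m)) atTop (𝓝 (opDet A)) :=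
    tendsto_opDet_of_nuclearLE hA hδ fun m => by
      convert hneg m using 1
      abel
  have l2 : Tendsto (fun m => opDet (1 + S * F m * S')) atTop (𝓝 (opDet (S * A * S'))) := by
    have hδ' := (hδ.const_mul ‖S‖).mul_const ‖S'‖
    rw [mul_zero, zero_mul] at hδ'
    refine tendsto_opDet_of_nuclearLE (hA.conj h) hδ' fun m => ?_
    have := ((hneg m).mul_left S).mul_right S'
    convert this using 1
    rw [mul_sub, mul_sub, sub_mul, sub_mul, mul_one, h]
    abel
  simp only [heq] at l2
  exact tendsto_nhds_unique l2 l1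

theorem opDet_ne_zero {A B : Ell2 →L[ℂ] Ell2} (hA : HasOpDet A) (hB : HasOpDet B)
    (h : A * B = 1) : opDet A ≠ 0 := fun h0 => by
  have := opDet_mul hA hB
  rw [h, h0, zero_mul, opDet_one] at this
  exact one_ne_zero this

/-! ### A criterion for trace class operators -/

theorem hasSum_norm_inner_sq {ι H : Type*} [NormedAddCommGroup H] [InnerProductSpace ℂ H]
    (b : HilbertBasis ι ℂ H) (x : H) : HasSum (fun i => ‖inner ℂ (b i) x‖ ^ 2) (‖x‖ ^ 2) := by
  have h := (b.hasSum_inner_mul_inner x x).mapL Complex.reCLM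
  rw [Complex.reCLM_apply, inner_self_eq_norm_sq_to_K] at h
  convert h using 1
  · ext i
    rw [Complex.reCLM_apply, ← inner_conj_symm x, Complex.conj_mul']
    norm_cast
  · norm_cast

/-- If the entries of the matrix of `K` are inner products `⟨V_k, U_j⟩` in some Hilbert space, with
`∑ ‖U_j‖² < ∞` and `∑ ‖V_k‖² < ∞`, then `K` is a product of two Hilbert–Schmidt operators, hence
trace class. -/
theorem isTraceClass_of_gram {H : Type*} [NormedAddCommGroup H] [InnerProductSpace ℂ H]
    [CompleteSpace H] {U V : ℕ → H} (hU : Summable fun j => ‖U j‖ ^ 2)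
    (hV : Summable fun k => ‖V k‖ ^ 2) {K : Ell2 →L[ℂ] Ell2}
    (hK : ∀ j k, inner ℂ (stdVec j) (K (stdVec k)) = inner ℂ (V k) (U j)) : IsTraceClass K := by
  obtain ⟨w, b, -⟩ := exists_hilbertBasis ℂ H
  have key : ∀ W : ℕ → H, (Summable fun j => ‖W j‖ ^ 2) →
      ∃ u : w → Ell2, (∀ i j, u i j = inner ℂ (b i) (W j)) ∧ Summable fun i => ‖u i‖ ^ 2 := by
    intro W hW
    have hle : ∀ i j, ‖inner ℂ (b i) (W j)‖ ^ 2 ≤ ‖W j‖ ^ 2 := fun i j => by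
      have := norm_inner_le_norm (𝕜 := ℂ) (b i) (W j)
      rw [b.orthonormal.1 i, one_mul] at this
      gcongr
    have hmem : ∀ i, Memℓp (fun j => inner ℂ (b i) (W j) : ℕ → ℂ) 2 := fun i => by
      refine memℓp_gen ?_
      simpa using Summable.of_nonneg_of_le (fun j => by positivity) (hle i) hW
    let u : w → Ell2 := fun i => ⟨fun j => inner ℂ (b i) (W j), hmem i⟩
    have hu : ∀ i, HasSum (fun j => ‖inner ℂ (b i) (W j)‖ ^ 2) (‖u i‖ ^ 2) := fun i => by
      simpa using lp.hasSum_norm (p := 2) (by simp) (u i)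
    have hprod : Summable fun p : ℕ × w => ‖inner ℂ (b p.2) (W p.1)‖ ^ 2 := by
      rw [summable_prod_of_nonneg fun p => by positivity]
      refine ⟨fun j => (hasSum_norm_inner_sq b (W j)).summable, ?_⟩
      simpa only [(hasSum_norm_inner_sq b (W _)).tsum_eq] using hW
    refine ⟨u, fun i j => rfl, ?_⟩
    have := (summable_prod_of_nonneg fun p => by positivity).1 hprod.prod_symm
    simpa only [Prod.swap, (hu _).tsum_eq] using this.2
  obtain ⟨u, hu, hus⟩ := key U hU
  obtain ⟨v, hv, hvs⟩ := key V hV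
  have hs : Summable fun i => ‖u i‖ * ‖v i‖ := by
    refine Summable.of_nonneg_of_le (fun i => by positivity) (fun i => ?_) (hus.add hvs)
    nlinarith [sq_nonneg (‖u i‖ - ‖v i‖), sq_nonneg ‖u i‖, sq_nonneg ‖v i‖]
  have hop : Summable fun i => InnerProductSpace.rankOne ℂ (u i) (v i) :=
    Summable.of_norm (by simpa using hs)
  have hKeq : ∑' i, InnerProductSpace.rankOne ℂ (u i) (v i) = K := by
    refine ext_matrix fun j k => ?_
    rw [hK]
    have h1 := (hop.hasSum.mapL (ContinuousLinearMap.apply ℂ Ell2 (stdVec k))).mapL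
      (innerSL ℂ (stdVec j))
    refine h1.unique ((b.hasSum_inner_mul_inner (V k) (U j)).congr_fun fun i => ?_)
    simp only [ContinuousLinearMap.apply_apply, innerSL_apply_apply,
      InnerProductSpace.rankOne_apply, inner_smul_right, inner_stdVec_left, inner_stdVec_right]
    rw [hu, hv, ← inner_conj_symm (V k)]
    rfl
  exact (nuclearLE_of_hasSum hs le_rfl (hKeq ▸ hop.hasSum)).isTraceClass

/-! ### Hankel operators with symbols in the Besov class -/

/-- The second difference `a(e^{ix+iy}) + a(e^{ix-iy}) - 2 a(e^{ix})` at `p = (y, x)`. -/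
noncomputable def secondDiff (a : 𝕋 → ℂ) (p : ℝ × 𝕋) : ℂ :=
  a (p.2 + (p.1 : 𝕋)) + a (p.2 - (p.1 : 𝕋)) - 2 * a p.2

/-- Finiteness of the Besov integral, taken over all `y > 0`. -/
def FiniteBesov (a : 𝕋 → ℂ) : Prop :=
  ∫⁻ y in Set.Ioi (0 : ℝ), ENNReal.ofReal (1 / y ^ 2) *
    ∫⁻ x, ‖secondDiff a (y, x)‖ₑ ∂haar < ∞

theorem lintegral_Ioo_eq (f : 𝕋 → ℝ≥0∞) :
    ∫⁻ x in Set.Ioo (-π) π, f (x : 𝕋) = ENNReal.ofReal (2 * π) * ∫⁻ x, f x ∂haar := by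
  have h := AddCircle.lintegral_preimage (2 * π) (-π) f
  rw [show -π + 2 * π = π by ring, AddCircle.volume_eq_smul_haarAddCircle,
    lintegral_smul_measure] at h
  exact (setLIntegral_congr Ioo_ae_eq_Ioc).trans h

theorem lintegral_secondDiff_le {a : 𝕋 → ℂ} (ha : AEStronglyMeasurable a haar) (y : ℝ) :
    ∫⁻ x, ‖secondDiff a (y, x)‖ₑ ∂haar ≤ 4 * ∫⁻ x, ‖a x‖ₑ ∂haar := by
  have h1 : ∫⁻ x, ‖a (x + (y : 𝕋))‖ₑ ∂haar = ∫⁻ x, ‖a x‖ₑ ∂haar :=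
    lintegral_add_right_eq_self (fun x => ‖a x‖ₑ) (y : 𝕋)
  have h2 : ∫⁻ x, ‖a (x - (y : 𝕋))‖ₑ ∂haar = ∫⁻ x, ‖a x‖ₑ ∂haar :=
    lintegral_sub_right_eq_self (fun x => ‖a x‖ₑ) (y : 𝕋)
  have hm := ha.enorm
  calc ∫⁻ x, ‖secondDiff a (y, x)‖ₑ ∂haar
      ≤ ∫⁻ x, (‖a (x + (y : 𝕋))‖ₑ + ‖a (x - (y : 𝕋))‖ₑ) + 2 * ‖a x‖ₑ ∂haar := by
        refine lintegral_mono fun x => ?_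
        refine (enorm_sub_le).trans (add_le_add (enorm_add_le _ _) ?_)
        rw [enorm_mul]
        gcongr
        rw [← ofReal_norm]
        simp
    _ = (∫⁻ x, ‖a (x + (y : 𝕋))‖ₑ + ‖a (x - (y : 𝕋))‖ₑ ∂haar) + ∫⁻ x, 2 * ‖a x‖ₑ ∂haar :=
        lintegral_add_right' _ (hm.const_mul 2)
    _ ≤ (∫⁻ x, ‖a (x + (y : 𝕋))‖ₑ ∂haar + ∫⁻ x, ‖a (x - (y : 𝕋))‖ₑ ∂haar) +
        2 * ∫⁻ x, ‖a x‖ₑ ∂haar := by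
        gcongr
        · rw [lintegral_add_right']
          exact (hm.comp_quasiMeasurePreserving
            (measurePreserving_sub_right haar (y : 𝕋)).quasiMeasurePreserving)
        · rw [lintegral_const_mul'' _ hm]
    _ = _ := by rw [h1, h2]; ring

/-- The values `y > π` are harmless, because `y⁻²` is integrable there. -/
theorem MemB11.finiteBesov {a : 𝕋 → ℂ} (ha : MemB11 a) : FiniteBesov a := by
  have hsub : Set.Ioi (0 : ℝ) ⊆ Set.Ioo (-π) π ∪ Set.Ioi 1 := fun y (hy : 0 < y) => by
    rcases lt_or_ge y π with h | h
    · exact Or.inl ⟨by linarith [Real.pi_pos], h⟩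
    · exact Or.inr (show 1 < y by linarith [Real.pi_gt_three])
  refine (lintegral_mono_set hsub).trans_lt ((lintegral_union_le _ _ _).trans_lt ?_)
  refine ENNReal.add_lt_top.2 ⟨?_, ?_⟩
  · have h := ha.2
    rw [besovNorm] at h
    have hI : ∀ y : ℝ, ∫⁻ x in Set.Ioo (-π) π,
        ‖a ((x + y : ℝ) : 𝕋) + a ((x - y : ℝ) : 𝕋) - 2 * a (x : 𝕋)‖ₑ =
        ENNReal.ofReal (2 * π) * ∫⁻ x, ‖secondDiff a (y, x)‖ₑ ∂haar := fun y =>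
      lintegral_Ioo_eq fun x => ‖secondDiff a (y, x)‖ₑ
    simp only [hI] at h
    have h2 : ∫⁻ y in Set.Ioo (-π) π, ENNReal.ofReal (1 / y ^ 2) *
        (ENNReal.ofReal (2 * π) * ∫⁻ x, ‖secondDiff a (y, x)‖ₑ ∂haar) =
        ENNReal.ofReal (2 * π) * ∫⁻ y in Set.Ioo (-π) π, ENNReal.ofReal (1 / y ^ 2) *
          ∫⁻ x, ‖secondDiff a (y, x)‖ₑ ∂haar := by
      rw [← lintegral_const_mul' _ _ ENNReal.ofReal_ne_top]
      refine lintegral_congr fun y => ?_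
      ring
    rw [h2] at h
    refine lt_top_iff_ne_top.2 fun htop => ?_
    rw [htop, ENNReal.mul_top (by simp [Real.pi_pos])] at h
    exact lt_irrefl _ h
  · have hint : IntegrableOn (fun y : ℝ => 1 / y ^ 2) (Set.Ioi 1) := by
      refine (integrableOn_Ioi_rpow_of_lt (show (-2 : ℝ) < -1 by norm_num) one_pos).congr_fun
        (fun y hy => ?_) measurableSet_Ioi
      have hy0 : (0 : ℝ) < y := one_pos.trans hy
      simp only
      rw [Real.rpow_neg hy0.le, one_div]
      norm_cast
    calc _ ≤ ∫⁻ y in Set.Ioi (1 : ℝ), ENNReal.ofReal (1 / y ^ 2) * (4 * ∫⁻ x, ‖a x‖ₑ ∂haar) :=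
          lintegral_mono fun y => mul_le_mul_right (lintegral_secondDiff_le
            ha.1.aestronglyMeasurable y) _
      _ = (∫⁻ y in Set.Ioi (1 : ℝ), ENNReal.ofReal (1 / y ^ 2)) *
          (4 * ∫⁻ x, ‖a x‖ₑ ∂haar) := by
          rw [lintegral_mul_const' _ _ (ENNReal.mul_ne_top (by simp) ha.1.2.ne)]
      _ < ∞ := ENNReal.mul_lt_top hint.lintegral_lt_top
          (ENNReal.mul_lt_top (by simp) ha.1.2)

theorem FiniteBesov.congr {a b : 𝕋 → ℂ} (ha : FiniteBesov a) (h : a =ᵐ[haar] b) :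
    FiniteBesov b := by
  have : ∀ y : ℝ, ∫⁻ x, ‖secondDiff b (y, x)‖ₑ ∂haar = ∫⁻ x, ‖secondDiff a (y, x)‖ₑ ∂haar := by
    intro y
    refine lintegral_congr_ae ?_
    filter_upwards [h, (measurePreserving_add_right haar (y : 𝕋)).quasiMeasurePreserving.ae_eq_comp
      h, (measurePreserving_sub_right haar (y : 𝕋)).quasiMeasurePreserving.ae_eq_comp h]
      with x h1 h2 h3
    simp only [Function.comp_apply] at h2 h3
    simp only [secondDiff, h1, h2, h3]
  simpa only [FiniteBesov, this] using ha

theorem FiniteBesov.tilde {a : 𝕋 → ℂ} (ha : FiniteBesov a) : FiniteBesov (tilde a) := by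
  have : ∀ y : ℝ, ∫⁻ x, ‖secondDiff (ToeplitzHankel.tilde a) (y, x)‖ₑ ∂haar =
      ∫⁻ x, ‖secondDiff a (y, x)‖ₑ ∂haar := by
    intro y
    rw [← lintegral_neg_eq_self]
    refine lintegral_congr fun x => ?_
    simp only [secondDiff, ToeplitzHankel.tilde]
    rw [show -(-x + (y : 𝕋)) = x - y by abel, show -(-x - (y : 𝕋)) = x + y by abel, neg_neg,
      add_comm (a (x - _))]
  simpa only [FiniteBesov, this] using ha

/-- The kernel whose integral over `t > 0` is the constant in the reproducing formula for Fourier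
coefficients in terms of second differences. -/
noncomputable def besovKernel (t : ℝ) : ℝ := t⁻¹ * Real.exp (-t) * (2 * Real.cos t - 2)

theorem besovKernel_nonpos {t : ℝ} (ht : 0 < t) : besovKernel t ≤ 0 :=
  mul_nonpos_of_nonneg_of_nonpos (by positivity) (by linarith [Real.cos_le_one t])

theorem integrableOn_besovKernel : IntegrableOn besovKernel (Set.Ioi 0) := by
  have h := Real.GammaIntegral_convergent (s := 2) (by norm_num)
  refine h.mono' (by unfold besovKernel; fun_prop) ?_
  filter_upwards [ae_restrict_mem measurableSet_Ioi] with t (ht : 0 < t)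
  rw [Real.norm_of_nonpos (besovKernel_nonpos ht), besovKernel]
  have h2 : 2 - 2 * Real.cos t ≤ t ^ 2 := by linarith [Real.one_sub_sq_div_two_le_cos (x := t)]
  have e : Real.exp (-t) * t ^ ((2 : ℝ) - 1) = t⁻¹ * Real.exp (-t) * t ^ 2 := by
    rw [show (2 : ℝ) - 1 = 1 by norm_num, Real.rpow_one]
    field_simp
  rw [e, ← mul_neg, neg_sub]
  gcongr

theorem integral_besovKernel_ne_zero : ∫ t in Set.Ioi (0 : ℝ), besovKernel t ≠ 0 := by
  have hpos : 0 < ∫ t in Set.Ioi (0 : ℝ), -besovKernel t := by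
    rw [setIntegral_pos_iff_support_of_nonneg_ae]
    · refine lt_of_lt_of_le (b := volume (Set.Ioo (0 : ℝ) π)) (by simp [Real.pi_pos])
        (measure_mono fun t ht => ⟨?_, ht.1⟩)
      have hc : Real.cos t < 1 := by
        simpa using Real.cos_lt_cos_of_nonneg_of_le_pi le_rfl ht.2.le ht.1
      have ht0 : t⁻¹ ≠ 0 := inv_ne_zero ht.1.ne'
      rw [Function.mem_support, besovKernel, neg_ne_zero]
      exact mul_ne_zero (mul_ne_zero ht0 (Real.exp_pos _).ne') (by linarith)
    · filter_upwards [ae_restrict_mem measurableSet_Ioi] with t ht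
      simpa using besovKernel_nonpos ht
    · exact integrableOn_besovKernel.neg
  rw [integral_neg] at hpos
  intro h
  rw [h] at hpos
  simp at hpos

theorem integral_fourier_mul_translate (a : 𝕋 → ℂ) (n : ℤ) (y : 𝕋) :
    ∫ x, a (x + y) * fourier (-n) x ∂haar = fourier n y * fourierCoeff a n := by
  rw [fourierCoeff, ← integral_const_mul,
    ← integral_add_right_eq_self (fun x => fourier n y * fourier (-n) x • a x) y]
  refine integral_congr_ae (Eventually.of_forall fun x => ?_)
  simp only [fourier_apply, smul_add, AddCircle.toCircle_add, Circle.coe_mul, smul_eq_mul]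
  have h : (AddCircle.toCircle (n • y) : ℂ) * (AddCircle.toCircle (-n • y) : ℂ) = 1 := by
    rw [← Circle.coe_mul, ← AddCircle.toCircle_add, neg_smul, add_neg_cancel]
    simp
  linear_combination (-(AddCircle.toCircle (-n • x) : ℂ) * a (x + y)) * h

theorem integral_secondDiff {a : 𝕋 → ℂ} (ha : Integrable a haar) (n : ℤ) (y : ℝ) :
    ∫ x, secondDiff a (y, x) * fourier (-n) x ∂haar =
      ((2 * Real.cos (n * y) - 2 : ℝ) : ℂ) * fourierCoeff a n := by
  have hb : ∀ b : 𝕋 → ℂ, Integrable b haar → Integrable (fun x => b x * fourier (-n) x) haar :=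
    fun b hb => hb.mul_bdd (c := 1) (fourier (-n)).continuous.aestronglyMeasurable
      (Eventually.of_forall fun x => by rw [fourier_apply, Circle.norm_coe])
  have h1 : Integrable (fun x => a (x + (y : 𝕋)) * fourier (-n) x) haar :=
    hb _ (ha.comp_add_right _)
  have h2 : Integrable (fun x => a (x + (-(y : 𝕋))) * fourier (-n) x) haar :=
    hb _ (ha.comp_add_right _)
  have h3 : Integrable (fun x => a (x + 0) * fourier (-n) x) haar :=
    hb _ (ha.comp_add_right _)
  have e : ∀ x : 𝕋, secondDiff a (y, x) * fourier (-n) x =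
      a (x + (y : 𝕋)) * fourier (-n) x + a (x + (-(y : 𝕋))) * fourier (-n) x -
        2 * (a (x + 0) * fourier (-n) x) := fun x => by
    simp only [secondDiff, add_zero, sub_eq_add_neg]; ring
  simp only [e]
  rw [integral_sub (by exact h1.add h2) (h3.const_mul 2), integral_add h1 h2, integral_const_mul,
    integral_fourier_mul_translate, integral_fourier_mul_translate,
    integral_fourier_mul_translate]
  have hc : fourier n (y : 𝕋) + fourier n (-(y : 𝕋)) = 2 * Complex.cos (n * y) := by
    rw [← AddCircle.coe_neg, fourier_coe_apply, fourier_coe_apply, Complex.two_cos]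
    have hpi : (π : ℂ) ≠ 0 := by exact_mod_cast Real.pi_ne_zero
    congr 2 <;> · push_cast; field_simp
  have h0 : fourier n (0 : 𝕋) = (1 : ℂ) := by simp
  rw [h0]
  push_cast
  linear_combination fourierCoeff a n * hc

/-- The measure `dy × haar` on `(0, ∞) × 𝕋`. -/
noncomputable abbrev besovMeasure : Measure (ℝ × 𝕋) := (volume.restrict (Set.Ioi 0)).prod haar

/-- The weighted second difference `y⁻² (a(e^{ix+iy}) + a(e^{ix-iy}) - 2 a(e^{ix}))`. -/
noncomputable def weightedDiff (a : 𝕋 → ℂ) (p : ℝ × 𝕋) : ℂ := ((1 / p.1 ^ 2 : ℝ) : ℂ) * secondDiff a p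

theorem measurable_weightedDiff {a : 𝕋 → ℂ} (ha : Measurable a) : Measurable (weightedDiff a) := by
  have h1 : Measurable fun p : ℝ × 𝕋 => (p.1 : 𝕋) :=
    AddCircle.measurable_mk'.comp measurable_fst
  unfold weightedDiff secondDiff
  have h2 := ha.comp (measurable_snd.add h1)
  have h3 := ha.comp (measurable_snd.sub h1)
  have h4 : Measurable fun p : ℝ × 𝕋 => a p.2 := ha.comp measurable_snd
  have h5 : Measurable fun p : ℝ × 𝕋 => ((1 / p.1 ^ 2 : ℝ) : ℂ) := by fun_prop
  exact h5.mul ((h2.add h3).sub (h4.const_mul 2))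

theorem integrable_weightedDiff {a : 𝕋 → ℂ} (ha : Measurable a) (hB : FiniteBesov a) :
    Integrable (weightedDiff a) besovMeasure := by
  refine ⟨(measurable_weightedDiff ha).aestronglyMeasurable, ?_⟩
  rw [HasFiniteIntegral, lintegral_prod _ (measurable_weightedDiff ha).enorm.aemeasurable]
  refine lt_of_eq_of_lt (lintegral_congr fun y => ?_) hB
  rw [← lintegral_const_mul' _ _ ENNReal.ofReal_ne_top]
  refine lintegral_congr fun x => ?_
  rw [weightedDiff, enorm_mul, ← ofReal_norm, Complex.norm_real,
    Real.norm_of_nonneg (by positivity)]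

/-- The substitution `t = n y` makes the `y`-integral independent of `n`. -/
theorem integral_weightedDiff {a : 𝕋 → ℂ} (ha : Measurable a) (hi : Integrable a haar)
    (hB : FiniteBesov a) {n : ℕ} (hn : 0 < n) :
    ∫ p, weightedDiff a p * ((p.1 * Real.exp (-(n * p.1)) : ℝ) * fourier (-(n : ℤ)) p.2)
      ∂besovMeasure = (∫ t in Set.Ioi (0 : ℝ), besovKernel t : ℝ) * fourierCoeff a n := by
  have hn0 : (0 : ℝ) < n := by exact_mod_cast hn
  have hint : Integrable (fun p : ℝ × 𝕋 => weightedDiff a p *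
      ((p.1 * Real.exp (-(n * p.1)) : ℝ) * fourier (-(n : ℤ)) p.2)) besovMeasure := by
    refine (integrable_weightedDiff ha hB).mul_bdd (c := 1) ?_ ?_
    · refine Continuous.aestronglyMeasurable ?_
      have := (fourier (T := 2 * π) (-(n : ℤ))).continuous
      fun_prop
    · have : ∀ᵐ p ∂besovMeasure, 0 < p.1 :=
        Measure.quasiMeasurePreserving_fst.ae (ae_restrict_mem measurableSet_Ioi)
      filter_upwards [this] with p hp
      rw [norm_mul, fourier_apply, Circle.norm_coe, mul_one, Complex.norm_real,
        Real.norm_of_nonneg (by positivity)]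
      have h1 : p.1 ≤ n * p.1 := le_mul_of_one_le_left hp.le (by exact_mod_cast hn)
      have h2 : n * p.1 ≤ Real.exp (n * p.1) := by linarith [Real.add_one_le_exp (n * p.1)]
      rw [Real.exp_neg, ← div_eq_mul_inv]
      exact div_le_one_of_le₀ (h1.trans h2) (Real.exp_pos _).le
  rw [integral_prod _ hint]
  have hin : ∀ y ∈ Set.Ioi (0 : ℝ), ∫ x, weightedDiff a (y, x) *
      ((y * Real.exp (-(n * y)) : ℝ) * fourier (-(n : ℤ)) x) ∂haar =
      ((n * besovKernel (n * y) : ℝ) : ℂ) * fourierCoeff a n := fun y hy => by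
    have hy0 : y ≠ 0 := (show 0 < y from hy).ne'
    have e : ∀ x, weightedDiff a (y, x) *
        ((y * Real.exp (-(n * y)) : ℝ) * fourier (-(n : ℤ)) x) =
        ((y⁻¹ * Real.exp (-(n * y)) : ℝ) : ℂ) * (secondDiff a (y, x) * fourier (-(n : ℤ)) x) :=
      fun x => by
        have : (y : ℂ) ≠ 0 := by exact_mod_cast hy0
        simp only [weightedDiff]
        push_cast
        field_simp
    simp only [e]
    rw [integral_const_mul, integral_secondDiff hi, ← mul_assoc, ← Complex.ofReal_mul]
    congr 2
    rw [besovKernel]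
    push_cast
    field_simp
  rw [setIntegral_congr_fun measurableSet_Ioi hin, integral_mul_const, integral_complex_ofReal,
    integral_const_mul, integral_comp_mul_left_Ioi besovKernel 0 hn0, mul_zero, smul_eq_mul,
    mul_inv_cancel_left₀ hn0.ne']

/-- The weight `√y e^{-(j + 1/2) y}`. -/
noncomputable def besovWeight (j : ℕ) (y : ℝ) : ℝ := √y * Real.exp (-((j + 1 / 2) * y))

theorem besovWeight_mul {y : ℝ} (hy : 0 ≤ y) (j k : ℕ) :
    besovWeight j y * besovWeight k y = y * Real.exp (-((j + k + 1 : ℕ) * y)) := by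
  rw [besovWeight, besovWeight, mul_mul_mul_comm, Real.mul_self_sqrt hy, ← Real.exp_add]
  congr 2
  push_cast
  ring

/-- The weights are square summable, uniformly in `y`, as `∑ y e^{-(2j+1)y} = y / (2 sinh y)`. -/
theorem sum_besovWeight_sq_le {y : ℝ} (hy : 0 ≤ y) (n : ℕ) :
    ∑ j ∈ Finset.range n, besovWeight j y ^ 2 ≤ 1 / 2 := by
  suffices h : ∑ j ∈ Finset.range n, besovWeight j y ^ 2 ≤
      (1 - Real.exp (-(2 * n * y))) / 2 by
    linarith [Real.exp_pos (-(2 * n * y))]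
  induction n with
  | zero => simp
  | succ n ih =>
    rw [Finset.sum_range_succ, sq, besovWeight_mul hy]
    have h1 := Real.self_le_sinh_iff.2 hy
    rw [Real.sinh_eq] at h1
    have h2 := mul_le_mul_of_nonneg_right h1 (Real.exp_pos (-((n + n + 1 : ℕ) * y))).le
    have e1 : Real.exp y * Real.exp (-((n + n + 1 : ℕ) * y)) = Real.exp (-(2 * n * y)) := by
      rw [← Real.exp_add]; congr 1; push_cast; ring
    have e2 : Real.exp (-y) * Real.exp (-((n + n + 1 : ℕ) * y)) =
        Real.exp (-(2 * (n + 1 : ℕ) * y)) := by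
      rw [← Real.exp_add]; congr 1; push_cast; ring
    have e3 : (Real.exp y - Real.exp (-y)) / 2 * Real.exp (-((n + n + 1 : ℕ) * y)) =
        (Real.exp (-(2 * n * y)) - Real.exp (-(2 * (n + 1 : ℕ) * y))) / 2 := by
      rw [← e1, ← e2]; ring
    rw [e3] at h2
    linarith

theorem norm_toLp_sq {α : Type*} [MeasurableSpace α] {μ : Measure α} {f : α → ℂ}
    (hf : MemLp f 2 μ) : ‖hf.toLp f‖ ^ 2 = ∫ x, ‖f x‖ ^ 2 ∂μ := by
  have h : ((‖hf.toLp f‖ ^ 2 : ℝ) : ℂ) = ((∫ x, ‖f x‖ ^ 2 ∂μ : ℝ) : ℂ) := by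
    have := inner_self_eq_norm_sq_to_K (𝕜 := ℂ) (hf.toLp f)
    rw [L2.inner_def] at this
    rw [Complex.ofReal_pow]
    refine this.symm.trans ?_
    rw [← integral_complex_ofReal]
    refine integral_congr_ae ?_
    filter_upwards [hf.coeFn_toLp] with x hx
    rw [hx, inner_self_eq_norm_sq_to_K]
    simp
  exact_mod_cast h

/-- If `|W_j|² = |f| w_j²` with `f` integrable and `w_j` the Besov weights, the functions `W_j` are
square summable in `L²`. -/
theorem summable_norm_toLp_sq {f : ℝ × 𝕋 → ℂ} (hf : Integrable f besovMeasure)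
    {W : ℕ → ℝ × 𝕋 → ℂ} (hW : ∀ j, AEStronglyMeasurable (W j) besovMeasure)
    (h : ∀ j p, ‖W j p‖ ^ 2 = ‖f p‖ * besovWeight j p.1 ^ 2) :
    ∃ hL : ∀ j, MemLp (W j) 2 besovMeasure, Summable fun j => ‖(hL j).toLp (W j)‖ ^ 2 := by
  have hpos : ∀ᵐ p ∂besovMeasure, 0 < p.1 :=
    Measure.quasiMeasurePreserving_fst.ae (ae_restrict_mem measurableSet_Ioi)
  have hint : ∀ j, Integrable (fun p => ‖W j p‖ ^ 2) besovMeasure := fun j => by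
    refine hf.norm.mono' ((hW j).norm.pow 2) ?_
    filter_upwards [hpos] with p hp
    rw [h, Real.norm_of_nonneg (by positivity)]
    have h1 := Finset.single_le_sum (f := fun j => besovWeight j p.1 ^ 2)
      (fun i _ => sq_nonneg _) (Finset.self_mem_range_succ j)
    have h2 := sum_besovWeight_sq_le hp.le (j + 1)
    exact mul_le_of_le_one_right (norm_nonneg _) (by linarith)
  refine ⟨fun j => (memLp_two_iff_integrable_sq_norm (hW j)).2 (hint j), ?_⟩
  simp only [norm_toLp_sq]
  refine summable_of_sum_range_le (c := ∫ p, ‖f p‖ ∂besovMeasure) (fun j => by positivity)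
    fun n => ?_
  rw [← integral_finsetSum _ fun j _ => hint j]
  refine integral_mono_ae (integrable_finsetSum _ fun j _ => hint j) hf.norm ?_
  filter_upwards [hpos] with p hp
  simp only [h, ← Finset.mul_sum]
  exact mul_le_of_le_one_right (norm_nonneg _) (by linarith [sum_besovWeight_sq_le hp.le n])

/-- Hankel operators with symbols in the Besov class `B₁¹` are trace class. -/
theorem FiniteBesov.isTraceClass_hankel {a : 𝕋 → ℂ} (ha : MemLp a ∞ haar) (hB : FiniteBesov a) :
    IsTraceClass (hankel a) := by
  wlog hm : Measurable a generalizing a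
  · obtain ⟨b, hb, hab⟩ := ha.1
    rw [hankel_congr hab]
    exact this ((memLp_congr_ae hab).1 ha) (hB.congr hab) hb.measurable
  have hi : Integrable a haar := ha.integrable le_top
  set f := weightedDiff a with hfdef
  have hf : Integrable f besovMeasure := integrable_weightedDiff hm hB
  have hfm : Measurable f := measurable_weightedDiff hm
  set κ : ℝ := ∫ t in Set.Ioi (0 : ℝ), besovKernel t
  have hκ : (κ : ℂ) ≠ 0 := by exact_mod_cast integral_besovKernel_ne_zero
  have hcw : ∀ j, Measurable fun p : ℝ × 𝕋 => (besovWeight j p.1 : ℂ) := fun j => by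
    unfold besovWeight; fun_prop
  have hfour : ∀ n : ℤ, Measurable fun p : ℝ × 𝕋 => fourier (T := 2 * π) n p.2 := fun n =>
    (fourier (T := 2 * π) n).continuous.measurable.comp measurable_snd
  have hsq : Measurable fun p => (√‖f p‖ : ℂ) := by fun_prop
  -- `f = (f / √|f|) · √|f|` splits the kernel into two square integrable factors
  let U : ℕ → ℝ × 𝕋 → ℂ := fun j p =>
    f p / (√‖f p‖ : ℂ) * besovWeight j p.1 * fourier (-(j : ℤ)) p.2
  let V : ℕ → ℝ × 𝕋 → ℂ := fun k p =>
    (√‖f p‖ : ℂ) * besovWeight k p.1 * fourier ((k : ℤ) + 1) p.2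
  obtain ⟨hU, hUs⟩ := summable_norm_toLp_sq (W := U) hf (fun j =>
    (((hfm.div hsq).mul (hcw j)).mul (hfour _)).aestronglyMeasurable) (fun j p => by
      simp only [U, norm_mul, norm_div, fourier_apply, Circle.norm_coe, Complex.norm_real,
        Real.norm_of_nonneg (Real.sqrt_nonneg _), mul_one, mul_pow, div_pow,
        Real.sq_sqrt (norm_nonneg _), Real.norm_eq_abs, sq_abs]
      rw [sq ‖f p‖, mul_self_div_self])
  obtain ⟨hV, hVs⟩ := summable_norm_toLp_sq (W := V) hf (fun j =>
    ((hsq.mul (hcw j)).mul (hfour _)).aestronglyMeasurable) (fun j p => by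
      simp only [V, norm_mul, fourier_apply, Circle.norm_coe, Complex.norm_real,
        Real.norm_of_nonneg (Real.sqrt_nonneg _), mul_one, mul_pow,
        Real.sq_sqrt (norm_nonneg _), Real.norm_eq_abs, sq_abs])
  have htr : IsTraceClass ((κ : ℂ) • hankel a) := by
    refine isTraceClass_of_gram hUs hVs fun j k => ?_
    rw [smul_apply, inner_smul_right, inner_hankel ha, L2.inner_def]
    have hcast : (j : ℤ) + k + 1 = ((j + k + 1 : ℕ) : ℤ) := by push_cast; ring
    rw [hcast, ← integral_weightedDiff hm hi hB (Nat.succ_pos _)]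
    refine integral_congr_ae ?_
    have hpos : ∀ᵐ p ∂besovMeasure, 0 < p.1 :=
      Measure.quasiMeasurePreserving_fst.ae (ae_restrict_mem measurableSet_Ioi)
    filter_upwards [hpos, (hU j).coeFn_toLp, (hV k).coeFn_toLp] with p hp h1 h2
    rw [h1, h2, RCLike.inner_apply, ← besovWeight_mul hp.le]
    simp only [U, V, map_mul, Complex.conj_ofReal]
    rw [← fourier_neg, show -((j + k + 1 : ℕ) : ℤ) = -(j : ℤ) + -((k : ℤ) + 1) by push_cast; ring,
      fourier_add]
    have h3 : f p / (√‖f p‖ : ℂ) * (√‖f p‖ : ℂ) = f p := by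
      refine div_mul_cancel_of_imp fun h0 => ?_
      simpa [Real.sqrt_eq_zero'] using h0
    rw [← hfdef]
    push_cast
    linear_combination (-(besovWeight j p.1 * besovWeight k p.1 * fourier (-(j : ℤ)) p.2 *
      fourier (-((k : ℤ) + 1)) p.2 : ℂ)) * h3
  have := htr.mul_left ((κ : ℂ)⁻¹ • 1)
  rwa [smul_mul_assoc, one_mul, inv_smul_smul₀ hκ] at this

/-! ### Invertibility of Toeplitz operators -/

theorem norm_mulOp_apply_le {a : 𝕋 → ℂ} (ha : MemLp a ∞ haar) {C : ℝ}
    (h : ∀ᵐ x ∂haar, ‖a x‖ ≤ C) (f : Lp ℂ 2 haar) : ‖mulOp a f‖ ≤ C * ‖f‖ := by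
  refine Lp.norm_le_mul_norm_of_ae_le_mul ?_
  filter_upwards [mulOp_coeFn ha f, h] with x h1 h2
  rw [h1, norm_mul]
  gcongr

theorem norm_mulOp_apply_eq {u : 𝕋 → ℂ} (hu : MemLp u ∞ haar) (h : ∀ x, ‖u x‖ = 1)
    (f : Lp ℂ 2 haar) : ‖mulOp u f‖ = ‖f‖ := by
  refine le_antisymm ((norm_mulOp_apply_le hu (C := 1) (Eventually.of_forall fun x =>
    (h x).le) f).trans_eq (one_mul _)) (Lp.norm_le_norm_of_ae_le ?_)
  filter_upwards [mulOp_coeFn hu f] with x hx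
  rw [hx, norm_mul, h, one_mul]

theorem norm_toeplitz_apply_le (a : 𝕋 → ℂ) (x : Ell2) :
    ‖toeplitz a x‖ ≤ ‖mulOp a (embPlus x)‖ := by
  have h : ‖(ContinuousLinearMap.adjoint embPlus.toContinuousLinearMap)‖ ≤ 1 := by
    rw [LinearIsometryEquiv.norm_map]
    exact embPlus.norm_toContinuousLinearMap_le
  exact ((ContinuousLinearMap.adjoint embPlus.toContinuousLinearMap).le_opNorm _).trans
    (mul_le_of_le_one_left (norm_nonneg _) h)

theorem norm_toeplitz_le {a : 𝕋 → ℂ} (ha : MemLp a ∞ haar) {C : ℝ} (hC : 0 ≤ C)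
    (h : ∀ᵐ x ∂haar, ‖a x‖ ≤ C) : ‖toeplitz a‖ ≤ C := by
  refine ContinuousLinearMap.opNorm_le_bound _ hC fun x => ?_
  refine (norm_toeplitz_apply_le a x).trans ((norm_mulOp_apply_le ha h _).trans_eq ?_)
  rw [LinearIsometry.norm_map]

theorem toeplitz_sub {a b : 𝕋 → ℂ} (ha : MemLp a ∞ haar) (hb : MemLp b ∞ haar) :
    toeplitz (a - b) = toeplitz a - toeplitz b := by
  have : mulOp (a - b) = mulOp a - mulOp b := by
    ext1 f
    apply Lp.ext
    rw [sub_apply]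
    filter_upwards [mulOp_coeFn (ha.sub hb) f, mulOp_coeFn ha f, mulOp_coeFn hb f,
      Lp.coeFn_sub (mulOp a f) (mulOp b f)] with x h1 h2 h3 h4
    rw [h4, Pi.sub_apply, h1, h2, h3, Pi.sub_apply, sub_mul]
  ext1 x
  simp only [toeplitz, this, sub_apply, ContinuousLinearMap.comp_apply, map_sub]

theorem memLp_of_continuous {a : 𝕋 → ℂ} (ha : Continuous a) : MemLp a ∞ haar :=
  ha.memLp_of_hasCompactSupport (HasCompactSupport.of_compactSpace a)

/-- Integrate the exponential series term by term: only frequencies `k n ≥ 0` occur. -/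
theorem memHPlus_exp (n : ℕ) (α : ℂ) :
    MemHPlus fun x => Complex.exp (α * fourier (T := 2 * π) n x) := by
  have hcont : ∀ j : ℤ, Continuous fun x : 𝕋 => fourier j x := fun j => (fourier j).continuous
  refine ⟨memLp_of_continuous (by have := hcont n; fun_prop), fun m hm => ?_⟩
  let F : ℕ → 𝕋 → ℂ := fun k x => fourier (-m) x * ((α * fourier n x) ^ k / (k.factorial : ℂ))
  have hF : ∀ k, Continuous (F k) := fun k => by
    have := hcont n
    have := hcont (-m)
    fun_prop
  have hFn : ∀ k x, ‖F k x‖ = ‖α‖ ^ k / k.factorial := fun k x => by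
    simp only [F, norm_mul, norm_div, norm_pow, fourier_apply, Circle.norm_coe, one_mul, mul_one,
      RCLike.norm_natCast]
  have hsum := hasSum_integral_of_summable_integral_norm (μ := haar) (F := F)
    (fun k => (memLp_of_continuous (hF k)).integrable le_top) (by
      simpa only [hFn, integral_const, probReal_univ, one_smul] using
        Real.summable_pow_div_factorial ‖α‖)
  have h0 : ∀ k, ∫ x, F k x ∂haar = 0 := fun k => by
    have hk := fourierCoeff_one (m - k * n)
    have hkn : (0 : ℤ) ≤ k * n := by positivity
    rw [if_neg (by omega), fourierCoeff] at hk
    have e : ∀ x, F k x = (α ^ k / k.factorial) *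
        (fourier (-(m - k * n)) x • (1 : 𝕋 → ℂ) x) := fun x => by
      have hpow : (fourier (n : ℤ) x : ℂ) ^ k = fourier ((k : ℤ) * n) x := by
        rw [fourier_apply, fourier_apply, mul_smul, natCast_zsmul _ k, AddCircle.toCircle_nsmul,
          Circle.coe_pow]
      simp only [F]
      rw [show -(m - (k : ℤ) * n) = -m + k * n by ring, fourier_add, ← hpow, mul_pow,
        Pi.one_apply, smul_eq_mul]
      ring
    simp only [e]
    rw [integral_const_mul, hk, mul_zero]
  simp only [h0] at hsum
  have hval : ∫ x, ∑' k, F k x ∂haar = 0 := hsum.unique hasSum_zero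
  rw [fourierCoeff, ← hval]
  refine integral_congr_ae (Eventually.of_forall fun x => ?_)
  simp only [F, smul_eq_mul]
  rw [tsum_mul_left, Complex.exp_eq_exp_ℂ, NormedSpace.exp_eq_tsum_div]

theorem isUnitHPlus_exp (n : ℕ) (α : ℂ) :
    IsUnitHPlus fun x => Complex.exp (α * fourier (T := 2 * π) n x) := by
  refine ⟨Eventually.of_forall fun x => Complex.exp_ne_zero _, memHPlus_exp n α, ?_⟩
  convert memHPlus_exp n (-α) using 2 with x
  rw [Pi.inv_apply, ← Complex.exp_neg, neg_mul]

/-- Multiplication of a bounded symbol by `h` preserves the invertibility of its Toeplitz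
operator. -/
def PreservesInvertibility (h : 𝕋 → ℂ) : Prop :=
  MemLp h ∞ haar ∧ ∀ ψ, MemLp ψ ∞ haar → IsUnit (toeplitz ψ) → IsUnit (toeplitz (ψ * h))

theorem PreservesInvertibility.mul {g h : 𝕋 → ℂ} (hg : PreservesInvertibility g)
    (hh : PreservesInvertibility h) : PreservesInvertibility (g * h) :=
  ⟨memLp_mul hg.1 hh.1, fun ψ hψ hu => by
    rw [← mul_assoc]; exact hh.2 _ (memLp_mul hψ hg.1) (hg.2 ψ hψ hu)⟩

theorem IsUnitHPlus.preservesInvertibility {h : 𝕋 → ℂ} (hh : IsUnitHPlus h) :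
    PreservesInvertibility h :=
  ⟨hh.2.1.1, fun ψ hψ hu => by
    rw [toeplitz_mul_hPlus hψ hh.2.1]; exact hu.mul hh.isUnit_toeplitz⟩

theorem IsUnitHMinus.preservesInvertibility {h : 𝕋 → ℂ} (hh : IsUnitHMinus h) :
    PreservesInvertibility h :=
  ⟨hh.2.1.1, fun ψ hψ hu => by
    rw [mul_comm, toeplitz_hMinus_mul hh.2.1 hψ]; exact hh.isUnit_toeplitz.mul hu⟩

/-- The exponential of a trigonometric polynomial is a product of units of `H^∞_±`. -/
theorem preservesInvertibility_exp_trigPoly {p : C(𝕋, ℂ)}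
    (hp : p ∈ Submodule.span ℂ (Set.range (fourier (T := 2 * π)))) (α : ℂ) :
    PreservesInvertibility fun x => Complex.exp (α * p x) := by
  induction hp using Submodule.span_induction generalizing α with
  | mem q hq =>
    obtain ⟨n, rfl⟩ := hq
    rcases le_or_gt 0 n with hn | hn
    · obtain ⟨k, rfl⟩ := Int.eq_ofNat_of_zero_le hn
      exact (isUnitHPlus_exp k α).preservesInvertibility
    · obtain ⟨k, rfl⟩ : ∃ k : ℕ, n = -(k : ℤ) := ⟨(-n).toNat, by omega⟩
      convert (isUnitHPlus_exp k α).tilde.preservesInvertibility using 2 with x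
      simp [tilde, fourier_apply]
  | zero =>
    refine ⟨memLp_of_continuous (by fun_prop), fun ψ hψ hu => ?_⟩
    convert hu using 2
    ext x
    simp
  | add q r _ _ hq hr =>
    convert (hq α).mul (hr α) using 1
    ext x
    rw [Pi.mul_apply, ← Complex.exp_add, ContinuousMap.add_apply, mul_add]
  | smul z q _ hq =>
    convert hq (α * z) using 3 with x
    rw [ContinuousMap.smul_apply, smul_eq_mul, mul_assoc]

/-- Approximate `G` by a trigonometric polynomial `p`; then `e^G = e^{G-p} e^p`, and the first
factor perturbs a Toeplitz operator only slightly. -/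
theorem preservesInvertibility_exp (G : C(𝕋, ℂ)) :
    PreservesInvertibility fun x => Complex.exp (G x) := by
  refine ⟨memLp_of_continuous (by fun_prop), fun ψ hψ hu => ?_⟩
  obtain ⟨ε, hε, hball⟩ := Metric.isOpen_iff.1 (Units.isOpen (R := Ell2 →L[ℂ] Ell2)) _ hu
  obtain ⟨M, hM0, hM⟩ : ∃ M : ℝ, 0 ≤ M ∧ ∀ᵐ x ∂haar, ‖ψ x‖ ≤ M :=
    ⟨(eLpNorm ψ ∞ haar).toReal, ENNReal.toReal_nonneg, by
      have h1 := ae_le_eLpNormEssSup (f := ψ) (μ := haar)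
      filter_upwards [h1] with x hx
      rw [← eLpNorm_exponent_top] at hx
      simpa using ENNReal.toReal_mono hψ.2.ne hx⟩
  obtain ⟨δ, hδ, hexp⟩ := Metric.continuous_iff.1 Complex.continuous_exp 0 (ε / (M + 1))
    (by positivity)
  have hcl : G ∈ closure (Submodule.span ℂ (Set.range (fourier (T := 2 * π))) :
      Set C(𝕋, ℂ)) := by
    have := span_fourier_closure_eq_top (T := 2 * π)
    rw [← Submodule.topologicalClosure_coe, this]
    trivial
  obtain ⟨p, hp, hpG⟩ := Metric.mem_closure_iff.1 hcl δ hδ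
  have hp' : PreservesInvertibility fun x => Complex.exp (p x) := by
    simpa using preservesInvertibility_exp_trigPoly hp 1
  let r : 𝕋 → ℂ := fun x => Complex.exp (G x - p x)
  have hr : MemLp r ∞ haar := memLp_of_continuous (by fun_prop)
  have hfac : ψ * (fun x => Complex.exp (G x)) = (ψ * r) * fun x => Complex.exp (p x) := by
    ext x
    simp only [Pi.mul_apply, r]
    rw [mul_assoc, ← Complex.exp_add, sub_add_cancel]
  rw [hfac]
  refine hp'.2 _ (memLp_mul hψ hr) (hball ?_)
  rw [Metric.mem_ball, dist_eq_norm, ← toeplitz_sub (memLp_mul hψ hr) hψ]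
  refine lt_of_le_of_lt (norm_toeplitz_le ((memLp_mul hψ hr).sub hψ)
    (C := M * (ε / (M + 1))) (by positivity) ?_) ?_
  · filter_upwards [hM] with x hx
    have h1 : ‖r x - 1‖ ≤ ε / (M + 1) := by
      have := hexp (G x - p x) (by
        rw [dist_zero_right, ← dist_eq_norm]
        exact (ContinuousMap.dist_apply_le_dist x).trans_lt hpG)
      rw [Complex.exp_zero, dist_eq_norm] at this
      exact this.le
    rw [Pi.sub_apply, Pi.mul_apply, ← mul_sub_one, norm_mul]
    gcongr
  · rw [mul_div_assoc', div_lt_iff₀ (by positivity)]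
    nlinarith

theorem HasWindingNumber.preservesInvertibility {c : 𝕋 → ℂ} (hc : HasWindingNumber c 0) :
    PreservesInvertibility c := by
  obtain ⟨g, hg, hgc, hper⟩ := hc
  have hper' : g 0 = g (2 * π) := by
    rw [Int.cast_zero, mul_zero, sub_eq_zero] at hper
    exact hper.symm
  let G : C(𝕋, ℂ) := ⟨AddCircle.liftIco (2 * π) 0 g,
    AddCircle.liftIco_zero_continuous hper' hg.continuousOn⟩
  suffices h : c = fun x => Complex.exp (G x) from h ▸ preservesInvertibility_exp G
  ext x
  obtain ⟨t, ht, rfl⟩ : ∃ t ∈ Set.Ico (0 : ℝ) (0 + 2 * π), (t : 𝕋) = x := by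
    have : x ∈ ((↑) : ℝ → 𝕋) '' Set.Ico (0 : ℝ) (0 + 2 * π) := by
      rw [AddCircle.coe_image_Ico_eq]; trivial
    exact this
  rw [zero_add] at ht
  rw [← hgc]
  exact congrArg Complex.exp (AddCircle.liftIco_zero_coe_apply ht).symm

theorem mulOp_fourier_fourierLp (n m : ℤ) :
    mulOp (fourier (T := 2 * π) n) (fourierLp 2 m) = fourierLp (T := 2 * π) 2 (n + m) := by
  apply Lp.ext
  filter_upwards [mulOp_coeFn (memLp_of_continuous (fourier (T := 2 * π) n).continuous)
    (fourierLp 2 m), coeFn_fourierLp (T := 2 * π) 2 m, coeFn_fourierLp (T := 2 * π) 2 (n + m)]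
    with x h1 h2 h3
  rw [h1, h2, h3, fourier_add]

/-- If `T(ψ)` is bounded below then so is multiplication by `ψ` on all of `L²(𝕋)`, since trigonometric
polynomials can be moved into the range of `embPlus` by a unimodular factor. -/
theorem norm_le_mul_norm_mulOp {ψ : 𝕋 → ℂ} (hψ : MemLp ψ ∞ haar) {C : ℝ} (hC : 0 ≤ C)
    (h : ∀ x, ‖x‖ ≤ C * ‖toeplitz ψ x‖) (f : Lp ℂ 2 haar) : ‖f‖ ≤ C * ‖mulOp ψ f‖ := by
  have hfour : ∀ n : ℤ, MemLp (fourier (T := 2 * π) n) ∞ haar := fun n =>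
    memLp_of_continuous (fourier (T := 2 * π) n).continuous
  have hnorm : ∀ (n : ℤ) (x : 𝕋), ‖fourier n x‖ = 1 := fun n x => by
    rw [fourier_apply, Circle.norm_coe]
  have hshift : ∀ f ∈ Submodule.span ℂ (Set.range (fourierLp (T := 2 * π) 2)), ∃ N : ℤ, ∀ n ≥ N,
      mulOp (fourier n) f ∈ LinearMap.range embPlus.toLinearMap := by
    intro f hf
    induction hf using Submodule.span_induction with
    | mem f hf =>
      obtain ⟨m, rfl⟩ := hf
      refine ⟨-m, fun n hn => ⟨stdVec (n + m).toNat, ?_⟩⟩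
      rw [mulOp_fourier_fourierLp]
      refine (embPlus_stdVec _).trans ?_
      rw [Int.toNat_of_nonneg (by omega)]
    | zero => exact ⟨0, fun n _ => by rw [map_zero]; exact Submodule.zero_mem _⟩
    | add f g _ _ hf hg =>
      obtain ⟨N, hN⟩ := hf
      obtain ⟨N', hN'⟩ := hg
      refine ⟨max N N', fun n hn => ?_⟩
      rw [map_add]
      exact Submodule.add_mem _ (hN n ((le_max_left _ _).trans hn))
        (hN' n ((le_max_right _ _).trans hn))
    | smul z f _ hf =>
      obtain ⟨N, hN⟩ := hf
      exact ⟨N, fun n hn => by rw [map_smul]; exact Submodule.smul_mem _ _ (hN n hn)⟩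
  have hclosed : IsClosed {f : Lp ℂ 2 haar | ‖f‖ ≤ C * ‖mulOp ψ f‖} :=
    isClosed_le continuous_norm (by fun_prop)
  have hdense : Dense (Submodule.span ℂ (Set.range (fourierLp (T := 2 * π) 2)) : Set
      (Lp ℂ 2 haar)) := by
    have := span_fourierLp_closure_eq_top (T := 2 * π) (p := 2) (by simp)
    exact Submodule.dense_iff_topologicalClosure_eq_top.2 this
  refine hclosed.closure_subset_iff.2 (fun f hf => ?_) (hdense f)
  obtain ⟨N, hN⟩ := hshift f hf
  obtain ⟨x, hx⟩ := hN N le_rfl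
  have hx' : embPlus x = mulOp (fourier N) f := hx
  have hcomm : mulOp ψ (mulOp (fourier N) f) = mulOp (fourier N) (mulOp ψ f) := by
    rw [← ContinuousLinearMap.comp_apply, ← ContinuousLinearMap.comp_apply,
      ← mulOp_mul hψ (hfour N), ← mulOp_mul (hfour N) hψ, mul_comm ψ]
  calc ‖f‖ = ‖x‖ := by
        rw [← norm_mulOp_apply_eq (hfour N) (hnorm N) f, ← hx', LinearIsometry.norm_map]
    _ ≤ C * ‖mulOp ψ (embPlus x)‖ := (h x).trans (by gcongr; exact norm_toeplitz_apply_le ψ x)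
    _ = C * ‖mulOp ψ f‖ := by rw [hx', hcomm, norm_mulOp_apply_eq (hfour N) (hnorm N)]

/-- The symbol of an invertible Toeplitz operator is bounded away from zero. -/
theorem exists_le_norm_of_isUnit_toeplitz {ψ : 𝕋 → ℂ} (hψ : MemLp ψ ∞ haar)
    (hu : IsUnit (toeplitz ψ)) : ∃ δ > 0, ∀ᵐ x ∂haar, δ ≤ ‖ψ x‖ := by
  obtain ⟨R, -, hR⟩ := isUnit_iff_exists.1 hu
  have hb : ∀ x, ‖x‖ ≤ ‖R‖ * ‖toeplitz ψ x‖ := fun x => by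
    have := R.le_opNorm (toeplitz ψ x)
    rwa [← mul_apply_eq_comp, hR, one_apply_eq_self] at this
  set δ := 1 / (2 * (‖R‖ + 1))
  have hδ : 0 < δ := by positivity
  refine ⟨δ, hδ, ?_⟩
  let S : Set 𝕋 := {x | ‖ψ x‖ < δ}
  have hS : NullMeasurableSet S haar :=
    nullMeasurableSet_lt hψ.1.norm.aemeasurable aemeasurable_const
  have hf : MemLp (S.indicator (1 : 𝕋 → ℂ)) 2 haar := by
    refine MemLp.of_bound (aestronglyMeasurable_const.indicator₀ hS) 1
      (Eventually.of_forall fun x => ?_)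
    by_cases hx : x ∈ S <;> simp [hx]
  have h1 := norm_le_mul_norm_mulOp hψ (norm_nonneg R) hb (hf.toLp _)
  have h2 : ‖mulOp ψ (hf.toLp _)‖ ≤ δ * ‖hf.toLp _‖ := by
    refine Lp.norm_le_mul_norm_of_ae_le_mul ?_
    filter_upwards [mulOp_coeFn hψ (hf.toLp _), hf.coeFn_toLp] with x h3 h4
    rw [h3, h4]
    by_cases hx : x ∈ S
    · have hx' : ‖ψ x‖ < δ := hx
      simpa [hx] using hx'.le
    · simp [hx]
  have h3 : ‖R‖ * δ ≤ 1 / 2 := by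
    rw [mul_one_div, div_le_div_iff₀ (by positivity) (by positivity)]
    linarith
  have h4 : ‖hf.toLp _‖ = 0 := by
    have := mul_le_mul_of_nonneg_left h2 (norm_nonneg R)
    have h5 := mul_le_mul_of_nonneg_right h3 (norm_nonneg (hf.toLp _))
    linarith [norm_nonneg (hf.toLp _)]
  have h5 : S.indicator (1 : 𝕋 → ℂ) =ᵐ[haar] 0 := by
    have h6 := hf.coeFn_toLp
    rw [norm_eq_zero.1 h4] at h6
    exact h6.symm.trans (Lp.coeFn_zero ℂ 2 haar)
  filter_upwards [h5] with x hx
  by_contra hlt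
  have hxS : x ∈ S := not_le.1 hlt
  simp [hxS] at hx

theorem ae_ne_zero_of_isUnit_toeplitz {ψ : 𝕋 → ℂ} (hψ : MemLp ψ ∞ haar)
    (hu : IsUnit (toeplitz ψ)) : ∀ᵐ x ∂haar, ψ x ≠ 0 := by
  obtain ⟨δ, hδ, h⟩ := exists_le_norm_of_isUnit_toeplitz hψ hu
  exact h.mono fun x hx => norm_pos_iff.1 (hδ.trans_le hx)

theorem memLp_inv_of_isUnit_toeplitz {ψ : 𝕋 → ℂ} (hψ : MemLp ψ ∞ haar)
    (hu : IsUnit (toeplitz ψ)) : MemLp ψ⁻¹ ∞ haar := by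
  obtain ⟨δ, hδ, h⟩ := exists_le_norm_of_isUnit_toeplitz hψ hu
  refine MemLp.of_bound hψ.1.aemeasurable.inv.aestronglyMeasurable δ⁻¹ (h.mono fun x hx => ?_)
  rw [Pi.inv_apply, norm_inv]
  exact inv_anti₀ hδ hx

/-- The operator whose matrix is the complex conjugate of that of `X`. -/
noncomputable def conjOp (X : Ell2 →L[ℂ] Ell2) : Ell2 →L[ℂ] Ell2 :=
  ((starₗᵢ ℂ : Ell2 ≃ₗᵢ⋆[ℂ] Ell2).toContinuousLinearEquiv : Ell2 →L⋆[ℂ] Ell2).comp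
    (X.comp ((starₗᵢ ℂ : Ell2 ≃ₗᵢ⋆[ℂ] Ell2).toContinuousLinearEquiv : Ell2 →L⋆[ℂ] Ell2))

theorem conjOp_apply (X : Ell2 →L[ℂ] Ell2) (x : Ell2) : conjOp X x = star (X (star x)) := rfl

theorem isUnit_conjOp {X : Ell2 →L[ℂ] Ell2} (hX : IsUnit X) : IsUnit (conjOp X) := by
  obtain ⟨Y, h1, h2⟩ := isUnit_iff_exists.1 hX
  refine isUnit_iff_exists.2 ⟨conjOp Y, ?_, ?_⟩ <;> ext1 x <;>
    rw [mul_apply_eq_comp, conjOp_apply, conjOp_apply, star_star, ← mul_apply_eq_comp]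
  · rw [h1, one_apply_eq_self, star_star, one_apply_eq_self]
  · rw [h2, one_apply_eq_self, star_star, one_apply_eq_self]

theorem isUnit_toeplitz_tilde {ψ : 𝕋 → ℂ} (hψ : MemLp ψ ∞ haar) (hu : IsUnit (toeplitz ψ)) :
    IsUnit (toeplitz (tilde ψ)) := by
  -- `T(ψ~)` is the transpose of `T(ψ)`
  have h : toeplitz (tilde ψ) = conjOp (ContinuousLinearMap.adjoint (toeplitz ψ)) := by
    refine ext_matrix fun j k => ?_
    have hk : star (stdVec k) = stdVec k := by
      ext i
      rw [lp.star_apply, stdVec, lp.single_apply]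
      by_cases hik : i = k <;> simp [hik]
    rw [inner_toeplitz (memLp_tilde hψ), fourierCoeff_tilde, conjOp_apply, hk, inner_stdVec_left,
      lp.star_apply, ← inner_stdVec_left, ContinuousLinearMap.adjoint_inner_right,
      ← inner_conj_symm, inner_toeplitz hψ]
    simp
  rw [h]
  exact isUnit_conjOp hu.star

/-- Inverse of `T(ψ⁻¹)` as a Schur complement: `T(ψ⁻¹)⁻¹ = T(ψ) - H(ψ) T(ψ~)⁻¹ H(ψ~)`. -/
theorem isUnit_toeplitz_inv {ψ : 𝕋 → ℂ} (hψ : MemLp ψ ∞ haar) (hu : IsUnit (toeplitz ψ)) :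
    IsUnit (toeplitz ψ⁻¹) := by
  have hi := memLp_inv_of_isUnit_toeplitz hψ hu
  have hae : ψ * ψ⁻¹ =ᵐ[haar] 1 := mul_inv_ae (ae_ne_zero_of_isUnit_toeplitz hψ hu)
  have hae' : ψ⁻¹ * ψ =ᵐ[haar] 1 := by rwa [mul_comm ψ⁻¹]
  obtain ⟨X, hX1, hX2⟩ := isUnit_iff_exists.1 (isUnit_toeplitz_tilde hψ hu)
  have e1 := toeplitz_mul hi hψ
  have e2 := hankel_mul hi hψ
  have e3 := toeplitz_mul hψ hi
  have e4 := hankel_mul (memLp_tilde hψ) (memLp_tilde hi)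
  rw [toeplitz_congr hae', toeplitz_one] at e1
  rw [hankel_congr hae', hankel_one] at e2
  rw [toeplitz_congr hae, toeplitz_one] at e3
  rw [← tilde_mul, hankel_congr (tilde_ae hae), show tilde 1 = 1 from rfl, hankel_one,
    tilde_tilde] at e4
  have f2 : toeplitz ψ⁻¹ * hankel ψ = -(hankel ψ⁻¹ * toeplitz (tilde ψ)) :=
    eq_neg_of_add_eq_zero_left e2.symm
  have f4 : hankel (tilde ψ) * toeplitz ψ⁻¹ = -(toeplitz (tilde ψ) * hankel (tilde ψ⁻¹)) :=
    eq_neg_of_add_eq_zero_right e4.symm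
  refine isUnit_iff_exists.2 ⟨toeplitz ψ - hankel ψ * X * hankel (tilde ψ), ?_, ?_⟩
  · rw [mul_sub, ← mul_assoc, ← mul_assoc, f2, neg_mul, mul_assoc _ _ X, hX1, mul_one, neg_mul,
      sub_neg_eq_add, e1]
  · rw [sub_mul, mul_assoc (hankel ψ * X), f4, mul_neg, mul_assoc (hankel ψ), ← mul_assoc X, hX2,
      one_mul, sub_neg_eq_add, e3]

/-! ### Determinants of invertible operators -/

theorem hasOpDet_unit_conj {A : Ell2 →L[ℂ] Ell2} (hA : HasOpDet A) (g : (Ell2 →L[ℂ] Ell2)ˣ) :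
    HasOpDet (g * A * ↑g⁻¹) :=
  hA.conj g.mul_inv

theorem opDet_unit_conj {A : Ell2 →L[ℂ] Ell2} (hA : HasOpDet A) (g : (Ell2 →L[ℂ] Ell2)ˣ) :
    opDet (g * A * ↑g⁻¹) = opDet A :=
  opDet_conj hA g.mul_inv g.inv_mul

theorem hasOpDet_rotate {A : Ell2 →L[ℂ] Ell2} {g : (Ell2 →L[ℂ] Ell2)ˣ} (hA : HasOpDet (A * g)) :
    HasOpDet (g * A) := by
  simpa [mul_assoc] using hasOpDet_unit_conj hA g

theorem opDet_rotate {A : Ell2 →L[ℂ] Ell2} {g : (Ell2 →L[ℂ] Ell2)ˣ} (hA : HasOpDet (A * g)) :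
    opDet (g * A) = opDet (A * g) := by
  rw [← opDet_unit_conj hA g]
  simp [mul_assoc]

theorem hasOpDet_unit_inv {u : (Ell2 →L[ℂ] Ell2)ˣ} (hu : HasOpDet (u : Ell2 →L[ℂ] Ell2)) :
    HasOpDet (↑u⁻¹ : Ell2 →L[ℂ] Ell2) := by
  have := IsTraceClass.mul_left hu (-(↑u⁻¹ : Ell2 →L[ℂ] Ell2))
  rw [HasOpDet]
  convert this using 1
  rw [mul_sub, neg_mul, Units.inv_mul, mul_one]
  abel

theorem opDet_unit_ne_zero {u : (Ell2 →L[ℂ] Ell2)ˣ} (hu : HasOpDet (u : Ell2 →L[ℂ] Ell2)) :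
    opDet (u : Ell2 →L[ℂ] Ell2) ≠ 0 :=
  opDet_ne_zero hu (hasOpDet_unit_inv hu) u.mul_inv

/-- Group commutators of units which commute modulo trace class operators. -/
theorem hasOpDet_commutator {x y : (Ell2 →L[ℂ] Ell2)ˣ}
    (h : IsTraceClass ((x * y - y * x : Ell2 →L[ℂ] Ell2))) :
    HasOpDet ((x * y * x⁻¹ * y⁻¹ : (Ell2 →L[ℂ] Ell2)ˣ) : Ell2 →L[ℂ] Ell2) := by
  have := h.mul_right (↑(x⁻¹ * y⁻¹) : Ell2 →L[ℂ] Ell2)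
  rw [HasOpDet]
  convert this using 1
  rw [sub_mul, ← Units.val_mul, ← Units.val_mul, ← Units.val_mul, ← Units.val_mul,
    show y * x * (x⁻¹ * y⁻¹) = 1 by group, ← mul_assoc, Units.val_one]

/-- `x y⁻¹ x⁻¹ y` is similar to the inverse of `x y x⁻¹ y⁻¹`. -/
theorem hasOpDet_commutator_inv {x y : (Ell2 →L[ℂ] Ell2)ˣ}
    (h : HasOpDet ((x * y * x⁻¹ * y⁻¹ : (Ell2 →L[ℂ] Ell2)ˣ) : Ell2 →L[ℂ] Ell2)) :
    HasOpDet ((x * y⁻¹ * x⁻¹ * y : (Ell2 →L[ℂ] Ell2)ˣ) : Ell2 →L[ℂ] Ell2) := by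
  have := hasOpDet_unit_conj (hasOpDet_unit_inv h) y⁻¹
  rw [← Units.val_mul, ← Units.val_mul] at this
  rwa [show y⁻¹ * (x * y * x⁻¹ * y⁻¹)⁻¹ * y⁻¹⁻¹ = x * y⁻¹ * x⁻¹ * y by group] at this

/-- The determinant of a commutator in terms of two determinants that compare `xy` and `yx` with a
third operator `z`. -/
theorem opDet_commutator_eq_div {x y z : (Ell2 →L[ℂ] Ell2)ˣ}
    (h1 : HasOpDet ((x⁻¹ * z * y⁻¹ : (Ell2 →L[ℂ] Ell2)ˣ) : Ell2 →L[ℂ] Ell2))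
    (h2 : HasOpDet ((y⁻¹ * z * x⁻¹ : (Ell2 →L[ℂ] Ell2)ˣ) : Ell2 →L[ℂ] Ell2)) :
    HasOpDet ((x * y⁻¹ * x⁻¹ * y : (Ell2 →L[ℂ] Ell2)ˣ) : Ell2 →L[ℂ] Ell2) ∧
    opDet ((x * y⁻¹ * x⁻¹ * y : (Ell2 →L[ℂ] Ell2)ˣ) : Ell2 →L[ℂ] Ell2) =
      opDet ((x⁻¹ * z * y⁻¹ : (Ell2 →L[ℂ] Ell2)ˣ) : Ell2 →L[ℂ] Ell2) /
        opDet ((y⁻¹ * z * x⁻¹ : (Ell2 →L[ℂ] Ell2)ˣ) : Ell2 →L[ℂ] Ell2) := by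
  set p := x⁻¹ * z * y⁻¹ with hp
  set q := y⁻¹ * z * x⁻¹ with hq
  have e : x * y⁻¹ * x⁻¹ * y = (x * y⁻¹) * p * (x * y⁻¹)⁻¹ * q⁻¹ := by
    rw [hp, hq]; group
  have hp' := hasOpDet_unit_conj h1 (x * y⁻¹)
  have hdet := opDet_unit_conj h1 (x * y⁻¹)
  have hq' := hasOpDet_unit_inv h2
  rw [← Units.val_mul, ← Units.val_mul] at hp' hdet
  refine ⟨by rw [e, Units.val_mul]; exact hp'.mul hq', ?_⟩
  rw [eq_div_iff (opDet_unit_ne_zero h2), e, Units.val_mul, opDet_mul hp' hq', hdet, mul_assoc,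
    ← opDet_mul hq' h2, Units.inv_mul, opDet_one, mul_one]

/-! ### The operator identities behind the determinant formulas -/

theorem EDefined.hasOpDet {A B : 𝕋 → ℂ} (h : EDefined A B) :
    HasOpDet ((toeplitz A)⁻¹ʳ * toeplitz (A * B) * (toeplitz B)⁻¹ʳ) := by
  obtain ⟨hA, hB, ⟨x, hx⟩, ⟨y, hy⟩, htr⟩ := h
  have := (htr.mul_left (↑x⁻¹)).mul_right (↑y⁻¹)
  rw [HasOpDet, toeplitz_mul hA hB, ← hx, ← hy, Ring.inverse_unit, Ring.inverse_unit]
  convert this using 1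
  rw [mul_add, add_mul, ← mul_assoc, Units.inv_mul, one_mul, Units.mul_inv, add_sub_cancel_left]

theorem isTraceClass_commutator_of_hankel {a b : 𝕋 → ℂ} (ha : MemLp a ∞ haar)
    (hb : MemLp b ∞ haar) (h1 : IsTraceClass (hankel a)) (h2 : IsTraceClass (hankel (tilde a))) :
    IsTraceClass (toeplitz a * toeplitz b - toeplitz b * toeplitz a) := by
  have e1 := toeplitz_mul ha hb
  have e2 := toeplitz_mul hb ha
  have e3 : toeplitz (a * b) = toeplitz (b * a) := by rw [mul_comm a b]
  have : toeplitz a * toeplitz b - toeplitz b * toeplitz a =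
      hankel b * hankel (tilde a) - hankel a * hankel (tilde b) := by
    rw [eq_sub_of_add_eq e1.symm, eq_sub_of_add_eq e2.symm, e3]
    abel
  rw [this]
  exact (h2.mul_left _).sub (h1.mul_right _)

theorem toeplitz_mul_toeplitz_tilde {φ : 𝕋 → ℂ} (hφ : MemLp φ ∞ haar)
    (hφφ : φ * tilde φ =ᵐ[haar] 1) :
    toeplitz φ * toeplitz (tilde φ) = 1 - hankel φ * hankel φ := by
  have := toeplitz_mul hφ (memLp_tilde hφ)
  rw [toeplitz_congr hφφ, toeplitz_one, tilde_tilde] at this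
  exact eq_sub_of_add_eq this.symm

theorem toeplitz_mul_hankel_tilde {φ : 𝕋 → ℂ} (hφ : MemLp φ ∞ haar)
    (hφφ : φ * tilde φ =ᵐ[haar] 1) :
    toeplitz φ * hankel (tilde φ) = -(hankel φ * toeplitz φ) := by
  have := hankel_mul hφ (memLp_tilde hφ)
  rw [hankel_congr hφφ, hankel_one, tilde_tilde] at this
  exact eq_neg_of_add_eq_zero_left this.symm

/-- `(1 - H(φ)) (1 + H(φ)) = T(φ) T(φ~)` is invertible. -/
theorem isUnit_opM_one {φ : 𝕋 → ℂ} (hφ : MemLp φ ∞ haar)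
    (hφφ : φ * tilde φ =ᵐ[haar] 1) (hu : IsUnit (toeplitz φ)) : IsUnit (opM 1 φ) := by
  have h := hu.mul (isUnit_toeplitz_tilde hφ hu)
  rw [toeplitz_mul_toeplitz_tilde hφ hφφ] at h
  have e : (1 : Ell2 →L[ℂ] Ell2) - hankel φ * hankel φ = (1 + hankel φ) * (1 - hankel φ) := by
    noncomm_ring
  have hc : Commute (1 + hankel φ) (1 - hankel φ) := by
    rw [Commute, SemiconjBy]; noncomm_ring
  rw [opM, toeplitz_one]
  rw [e, hc.isUnit_mul_iff] at h
  exact h.1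

theorem opM_mul_eq {a φ : 𝕋 → ℂ} (ha : MemLp a ∞ haar) (hφ : MemLp φ ∞ haar) :
    opM a (a * φ) = toeplitz a * opM 1 φ + hankel a * toeplitz (tilde φ) := by
  rw [opM, opM, hankel_mul ha hφ, toeplitz_one, mul_add, mul_one, add_assoc]

/-- `M(a, aφ) M(1, φ)⁻¹ = M(aφ, a) T(φ)⁻¹`. -/
theorem opM_mul_swap {a φ : 𝕋 → ℂ} (ha : MemLp a ∞ haar)
    (hφ : MemLp φ ∞ haar) (hφφ : φ * tilde φ =ᵐ[haar] 1) {t : (Ell2 →L[ℂ] Ell2)ˣ}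
    (ht : ↑t = toeplitz φ) : opM a (a * φ) = opM (a * φ) a * ↑t⁻¹ * opM 1 φ := by
  have e1 := toeplitz_mul_toeplitz_tilde hφ hφφ
  have e2 := toeplitz_mul_hankel_tilde hφ hφφ
  rw [← ht] at e1 e2
  have e3 : hankel (tilde φ) * ↑t⁻¹ = -(↑t⁻¹ * hankel φ) := by
    calc hankel (tilde φ) * ↑t⁻¹ = ↑t⁻¹ * (↑t * hankel (tilde φ)) * ↑t⁻¹ := by
          rw [← mul_assoc, Units.inv_mul, one_mul]
      _ = -(↑t⁻¹ * hankel φ) := by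
          rw [e2, mul_neg, neg_mul, ← mul_assoc, mul_assoc _ (t : Ell2 →L[ℂ] Ell2),
            Units.mul_inv, mul_one]
  have e4 : (hankel (tilde φ) + 1) * ↑t⁻¹ * (1 + hankel φ) = toeplitz (tilde φ) := by
    calc (hankel (tilde φ) + 1) * ↑t⁻¹ * (1 + hankel φ)
        = ↑t⁻¹ * (1 - hankel φ * hankel φ) := by rw [add_mul, e3]; noncomm_ring
      _ = toeplitz (tilde φ) := by rw [← e1, ← mul_assoc, Units.inv_mul, one_mul]
  have e5 : opM 1 φ = 1 + hankel φ := by rw [opM, toeplitz_one]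
  have e6 : opM (a * φ) a = toeplitz a * t + hankel a * (hankel (tilde φ) + 1) := by
    rw [opM, toeplitz_mul ha hφ, ht, mul_add, mul_one, add_assoc]
  rw [opM_mul_eq ha hφ, e6, e5, ← e4, add_mul (toeplitz a * ↑t), Units.mul_inv_cancel_right,
    add_mul (toeplitz a)]
  simp only [mul_assoc]

/-- The standing assumptions on `c` and `d₊` in terms of Toeplitz and Hankel operators, with
`d₊` written as `dp`. The operators `H(d₊~)` and `H(d₊~⁻¹)` vanish because `d₊` is a unit of `H^∞_+`. -/
structure GoodSymbols (c dp : 𝕋 → ℂ) : Prop where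
  memLp : MemLp c ∞ haar
  preserves : PreservesInvertibility c
  unit : IsUnitHPlus dp
  hankel_left : IsTraceClass (hankel c)
  hankel_tilde_left : IsTraceClass (hankel (tilde c))
  hankel_right : IsTraceClass (hankel dp)
  hankel_inv_right : IsTraceClass (hankel dp⁻¹)

namespace GoodSymbols

variable {c dp : 𝕋 → ℂ}

theorem memLp_mul (h : GoodSymbols c dp) : MemLp (c * dp) ∞ haar :=
  ToeplitzHankel.memLp_mul h.memLp h.unit.2.1.1

theorem preserves_mul (h : GoodSymbols c dp) : PreservesInvertibility (c * dp) :=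
  h.preserves.mul h.unit.preservesInvertibility

theorem isUnit_toeplitz_left (h : GoodSymbols c dp) : IsUnit (toeplitz c) := by
  simpa using h.preserves.2 1 memLp_one (by simp)

theorem toeplitz_mul_eq (h : GoodSymbols c dp) :
    toeplitz (c * dp) = toeplitz c * toeplitz dp :=
  toeplitz_mul_hPlus h.memLp h.unit.2.1

theorem isUnit_toeplitz_mul (h : GoodSymbols c dp) : IsUnit (toeplitz (c * dp)) := by
  rw [h.toeplitz_mul_eq]
  exact h.isUnit_toeplitz_left.mul h.unit.isUnit_toeplitz

theorem hankel_mul (h : GoodSymbols c dp) : IsTraceClass (hankel (c * dp)) := by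
  rw [ToeplitzHankel.hankel_mul h.memLp h.unit.2.1.1]
  exact (h.hankel_right.mul_left _).add (h.hankel_left.mul_right _)

theorem hankel_tilde_mul (h : GoodSymbols c dp) : IsTraceClass (hankel (tilde (c * dp))) := by
  rw [tilde_mul, mul_comm (tilde c), hankel_hMinus_mul h.unit.2.1.tilde (memLp_tilde h.memLp)]
  exact h.hankel_tilde_left.mul_left _

theorem mul_ae {d : 𝕋 → ℂ} (φ : 𝕋 → ℂ) (hd : d =ᵐ[haar] dp * (tilde dp)⁻¹) :
    c * d * φ =ᵐ[haar] (c * dp * φ) * tilde dp⁻¹ := by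
  filter_upwards [hd] with x hx
  simp only [Pi.mul_apply, hx, tilde_inv]
  ring

/-- `M(c, cdφ) = M(c d₊, c d₊ φ) T(d₊⁻¹)`. -/
theorem opM_eq (h : GoodSymbols c dp) {d φ : 𝕋 → ℂ} (hd : d =ᵐ[haar] dp * (tilde dp)⁻¹)
    (hφ : MemLp φ ∞ haar) :
    opM c (c * d * φ) = opM (c * dp) (c * dp * φ) * toeplitz dp⁻¹ := by
  rw [opM, opM, hankel_congr (mul_ae φ hd), hankel_mul_hMinus
    (ToeplitzHankel.memLp_mul h.memLp_mul hφ) h.unit.inv.2.1.tilde, tilde_tilde, add_mul,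
    h.toeplitz_mul_eq, mul_assoc (toeplitz c), h.unit.mul_toeplitz_inv, mul_one]

end GoodSymbols

theorem goodSymbols_of_besov {c dp : 𝕋 → ℂ} (hc_cont : Continuous c) (hc : MemB11 c)
    (hcw : HasWindingNumber c 0) (hdp : IsUnitHPlus dp) (h1 : MemB11 dp) (h2 : MemB11 dp⁻¹) :
    GoodSymbols c dp where
  memLp := memLp_of_continuous hc_cont
  preserves := hcw.preservesInvertibility
  unit := hdp
  hankel_left := hc.finiteBesov.isTraceClass_hankel (memLp_of_continuous hc_cont)
  hankel_tilde_left := hc.finiteBesov.tilde.isTraceClass_hankel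
    (memLp_tilde (memLp_of_continuous hc_cont))
  hankel_right := h1.finiteBesov.isTraceClass_hankel hdp.2.1.1
  hankel_inv_right := h2.finiteBesov.isTraceClass_hankel hdp.2.2.1

/-! ### The determinant formulas -/

/-- `T(d₊)` commutes with every Toeplitz operator modulo trace class operators, since `H(d₊)` is
trace class and `H(d₊~) = 0`. -/
theorem hasOpDet_commutator_symbols {c dp : 𝕋 → ℂ} (h : GoodSymbols c dp) {b : 𝕋 → ℂ}
    (hb : MemLp b ∞ haar) {w v : (Ell2 →L[ℂ] Ell2)ˣ} (hw : ↑w = toeplitz dp)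
    (hv : ↑v = toeplitz b) :
    HasOpDet ((w * v * w⁻¹ * v⁻¹ : (Ell2 →L[ℂ] Ell2)ˣ) : Ell2 →L[ℂ] Ell2) := by
  refine hasOpDet_commutator ?_
  rw [hw, hv]
  refine isTraceClass_commutator_of_hankel h.unit.2.1.1 hb h.hankel_right ?_
  rw [h.unit.2.1.tilde.hankel_eq_zero]
  exact isTraceClass_zero

/-- `w⁻¹v⁻¹wv` is similar to `wvw⁻¹v⁻¹`. -/
theorem opDet_commutator_conj {w v : (Ell2 →L[ℂ] Ell2)ˣ}
    (h : HasOpDet ((w * v * w⁻¹ * v⁻¹ : (Ell2 →L[ℂ] Ell2)ˣ) : Ell2 →L[ℂ] Ell2)) :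
    HasOpDet ((w⁻¹ * v⁻¹ * w * v : (Ell2 →L[ℂ] Ell2)ˣ) : Ell2 →L[ℂ] Ell2) ∧
    opDet ((w⁻¹ * v⁻¹ * w * v : (Ell2 →L[ℂ] Ell2)ˣ) : Ell2 →L[ℂ] Ell2) =
      opDet ((w * v * w⁻¹ * v⁻¹ : (Ell2 →L[ℂ] Ell2)ˣ) : Ell2 →L[ℂ] Ell2) := by
  have e : w⁻¹ * v⁻¹ * w * v = (w * v)⁻¹ * (w * v * w⁻¹ * v⁻¹) * (w * v)⁻¹⁻¹ := by group
  have h1 := hasOpDet_unit_conj h (w * v)⁻¹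
  have h2 := opDet_unit_conj h (w * v)⁻¹
  rw [← Units.val_mul, ← Units.val_mul, ← e] at h1 h2
  exact ⟨h1, h2⟩

/-- Up to similarity, the operator in `E₁` is the product of a commutator of `T(ψ)` and `T(c d₊)`,
the operator `T(c d₊)⁻¹ M(c d₊, c d₊ φ) M(1, φ)⁻¹` and a commutator of `T(d₊)` and `T(ψ⁻¹)`. -/
theorem opDet_opE1 {ψ φ c d dp : 𝕋 → ℂ} (h : GoodSymbols c dp) (hψ : MemLp ψ ∞ haar)
    (hψi : MemLp ψ⁻¹ ∞ haar) (hφ : MemLp φ ∞ haar) (hd : d =ᵐ[haar] dp * (tilde dp)⁻¹)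
    {x y v w m : (Ell2 →L[ℂ] Ell2)ˣ} (hx : ↑x = toeplitz ψ) (hy : ↑y = toeplitz (c * dp))
    (hv : ↑v = toeplitz ψ⁻¹) (hw : ↑w = toeplitz dp) (hm : ↑m = opM 1 φ) :
    HasOpDet (opE1 ψ φ c d dp) ∧
    HasOpDet (↑y⁻¹ * opM (c * dp) (c * dp * φ) * ↑m⁻¹) ∧
    opDet (opE1 ψ φ c d dp) =
      opDet ((x * y⁻¹ * x⁻¹ * y : (Ell2 →L[ℂ] Ell2)ˣ) : Ell2 →L[ℂ] Ell2) *
      opDet ((w * v * w⁻¹ * v⁻¹ : (Ell2 →L[ℂ] Ell2)ˣ) : Ell2 →L[ℂ] Ell2) *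
      opDet (↑y⁻¹ * opM (c * dp) (c * dp * φ) * ↑m⁻¹) := by
  set M := opM (c * dp) (c * dp * φ) with hM
  have hP : HasOpDet ((x * y⁻¹ * x⁻¹ * y : (Ell2 →L[ℂ] Ell2)ˣ) : Ell2 →L[ℂ] Ell2) := by
    refine hasOpDet_commutator_inv (hasOpDet_commutator ?_)
    rw [hx, hy, ← neg_sub]
    exact (isTraceClass_commutator_of_hankel h.memLp_mul hψ h.hankel_mul h.hankel_tilde_mul).neg
  have hC := hasOpDet_commutator_symbols h hψi hw hv
  obtain ⟨hC1, hC2⟩ := opDet_commutator_conj hC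
  have hQ : HasOpDet (↑y⁻¹ * M * ↑m⁻¹) := by
    have := (h.hankel_mul.mul_left ↑y⁻¹).mul_right (toeplitz (tilde φ) * ↑m⁻¹)
    rw [HasOpDet, hM, opM_mul_eq h.memLp_mul hφ, ← hy, ← hm]
    convert this using 1
    rw [mul_add, add_mul, ← mul_assoc, Units.inv_mul, one_mul, Units.mul_inv, add_sub_cancel_left]
    simp only [mul_assoc]
  have hwi : toeplitz dp⁻¹ = ↑w⁻¹ :=
    (Units.inv_eq_of_mul_eq_one_right (by rw [hw, h.unit.mul_toeplitz_inv])).symm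
  have hmC := hasOpDet_unit_conj hC1 m
  have e : opE1 ψ φ c d dp = ↑x⁻¹ * (((x * y⁻¹ * x⁻¹ * y : (Ell2 →L[ℂ] Ell2)ˣ) : Ell2 →L[ℂ] Ell2) *
      (↑y⁻¹ * M * ↑m⁻¹) *
      (m * ((w⁻¹ * v⁻¹ * w * v : (Ell2 →L[ℂ] Ell2)ˣ) : Ell2 →L[ℂ] Ell2) * ↑m⁻¹)) * ↑x⁻¹⁻¹ := by
    rw [opE1, h.opM_eq hd hφ, hwi, ← hx, ← hy, ← hv, ← hw, ← hm]
    simp only [Ring.inverse_unit, Units.val_mul, mul_assoc, inv_inv, Units.inv_mul_cancel_left,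
      Units.mul_inv_cancel_left, hM]
  have hprod := (hP.mul hQ).mul hmC
  refine ⟨e ▸ hasOpDet_unit_conj hprod x⁻¹, hQ, ?_⟩
  rw [e, opDet_unit_conj hprod, opDet_mul (hP.mul hQ) hmC, opDet_mul hP hQ, opDet_unit_conj hC1,
    hC2]
  ring

theorem e1Defined_of_isUnit {ψ φ c d dp : 𝕋 → ℂ} (h : GoodSymbols c dp) (hψ : MemLp ψ ∞ haar)
    (hφ : MemLp φ ∞ haar) (hTψ : IsUnit (toeplitz ψ)) (hd : d =ᵐ[haar] dp * (tilde dp)⁻¹)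
    (hM : IsUnit (opM 1 φ)) : E1Defined ψ φ c d dp := by
  have hψi := memLp_inv_of_isUnit_toeplitz hψ hTψ
  obtain ⟨x, hx⟩ := id hTψ
  obtain ⟨y, hy⟩ := h.isUnit_toeplitz_mul
  obtain ⟨v, hv⟩ := isUnit_toeplitz_inv hψ hTψ
  obtain ⟨w, hw⟩ := h.unit.isUnit_toeplitz
  obtain ⟨m, hm⟩ := id hM
  refine ⟨ae_ne_zero_of_isUnit_toeplitz hψ hTψ, hψi, h.memLp_mul, ?_, h.isUnit_toeplitz_mul, hTψ,
    isUnit_toeplitz_inv hψ hTψ, hM, (opDet_opE1 h hψ hψi hφ hd hx hy hv hw hm).1⟩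
  exact (memLp_congr_ae (GoodSymbols.mul_ae φ hd)).2
    (memLp_mul (memLp_mul h.memLp_mul hφ) (memLp_tilde h.unit.2.2.1))

theorem GoodSymbols.eDefined {c dp ψ : 𝕋 → ℂ} (h : GoodSymbols c dp) (hψ : MemLp ψ ∞ haar)
    (hTψ : IsUnit (toeplitz ψ)) : EDefined ψ (c * dp) ∧ EDefined (c * dp) ψ :=
  ⟨⟨hψ, h.memLp_mul, hTψ, h.isUnit_toeplitz_mul, h.hankel_tilde_mul.mul_left _⟩,
    ⟨h.memLp_mul, hψ, h.isUnit_toeplitz_mul, hTψ, h.hankel_mul.mul_right _⟩⟩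

/-- The quotient `E[ψ, a] / E[a, ψ]` is the determinant of a commutator of `T(ψ)` and `T(a)`. -/
theorem constE_div_constE {ψ a : 𝕋 → ℂ} (h1 : EDefined ψ a) (h2 : EDefined a ψ)
    (hz : IsUnit (toeplitz (ψ * a))) {x y : (Ell2 →L[ℂ] Ell2)ˣ} (hx : ↑x = toeplitz ψ)
    (hy : ↑y = toeplitz a) :
    HasOpDet ((x * y⁻¹ * x⁻¹ * y : (Ell2 →L[ℂ] Ell2)ˣ) : Ell2 →L[ℂ] Ell2) ∧ constE a ψ ≠ 0 ∧
    opDet ((x * y⁻¹ * x⁻¹ * y : (Ell2 →L[ℂ] Ell2)ˣ) : Ell2 →L[ℂ] Ell2) =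
      constE ψ a / constE a ψ := by
  obtain ⟨z, hz⟩ := hz
  have d1 := h1.hasOpDet
  have d2 := h2.hasOpDet
  have e1 : constE ψ a =
      opDet ((x⁻¹ * z * y⁻¹ : (Ell2 →L[ℂ] Ell2)ˣ) : Ell2 →L[ℂ] Ell2) := by
    rw [constE, ← hz, ← hx, ← hy, Ring.inverse_unit, Ring.inverse_unit, Units.val_mul,
      Units.val_mul]
  have e2 : constE a ψ =
      opDet ((y⁻¹ * z * x⁻¹ : (Ell2 →L[ℂ] Ell2)ˣ) : Ell2 →L[ℂ] Ell2) := by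
    rw [constE, mul_comm a ψ, ← hz, ← hx, ← hy, Ring.inverse_unit, Ring.inverse_unit,
      Units.val_mul, Units.val_mul]
  rw [← hz, ← hx, ← hy, Ring.inverse_unit, Ring.inverse_unit, ← Units.val_mul,
    ← Units.val_mul] at d1
  rw [mul_comm a ψ, ← hz, ← hx, ← hy, Ring.inverse_unit, Ring.inverse_unit, ← Units.val_mul,
    ← Units.val_mul] at d2
  obtain ⟨hP, hdet⟩ := opDet_commutator_eq_div d1 d2
  exact ⟨hP, e2 ▸ opDet_unit_ne_zero d2, by rw [hdet, e1, e2]⟩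

theorem GoodSymbols.eDefined_inv {c dp b : 𝕋 → ℂ} (h : GoodSymbols c dp) (hb : MemLp b ∞ haar)
    (hTb : IsUnit (toeplitz b)) : EDefined dp⁻¹ b :=
  ⟨h.unit.2.2.1, hb, h.unit.inv.isUnit_toeplitz, hTb, h.hankel_inv_right.mul_right _⟩

/-- `E[d₊⁻¹, b]` is the determinant of a commutator of `T(d₊)` and `T(b)`. -/
theorem GoodSymbols.constE_inv {c dp b : 𝕋 → ℂ} (h : GoodSymbols c dp) (hb : MemLp b ∞ haar)
    {w v : (Ell2 →L[ℂ] Ell2)ˣ} (hw : ↑w = toeplitz dp) (hv : ↑v = toeplitz b) :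
    constE dp⁻¹ b = opDet ((w * v * w⁻¹ * v⁻¹ : (Ell2 →L[ℂ] Ell2)ˣ) : Ell2 →L[ℂ] Ell2) := by
  have hwi : toeplitz dp⁻¹ = ↑w⁻¹ :=
    (Units.inv_eq_of_mul_eq_one_right (by rw [hw, h.unit.mul_toeplitz_inv])).symm
  rw [constE, mul_comm dp⁻¹ b, toeplitz_mul_hPlus hb h.unit.2.2, hwi, ← hv, Ring.inverse_unit,
    Ring.inverse_unit, inv_inv]
  simp only [Units.val_mul, mul_assoc]

/-- The remaining factor of `E₁` when `T(φ)` is invertible. -/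
theorem GoodSymbols.opDet_opM {c dp φ : 𝕋 → ℂ} (h : GoodSymbols c dp) (hφ : MemLp φ ∞ haar)
    (hφφ : φ * tilde φ =ᵐ[haar] 1) {y m s t : (Ell2 →L[ℂ] Ell2)ˣ}
    (hy : ↑y = toeplitz (c * dp)) (hm : ↑m = opM 1 φ) (ht : ↑t = toeplitz φ)
    (hs : ↑s = toeplitz (c * dp * φ)) :
    HasOpDet ((toeplitz (c * dp * φ) + hankel (c * dp)) * (toeplitz (c * dp * φ))⁻¹ʳ) ∧
    opDet (↑y⁻¹ * opM (c * dp) (c * dp * φ) * ↑m⁻¹) = constE (c * dp) φ *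
      opDet ((toeplitz (c * dp * φ) + hankel (c * dp)) * (toeplitz (c * dp * φ))⁻¹ʳ) := by
  have hE : EDefined (c * dp) φ := ⟨h.memLp_mul, hφ, h.isUnit_toeplitz_mul, ⟨t, ht⟩,
    h.hankel_mul.mul_right _⟩
  have hEd := hE.hasOpDet
  rw [constE]
  rw [← hs, ← hy, ← ht, Ring.inverse_unit, Ring.inverse_unit] at hEd
  rw [← hs, ← hy, ← ht, Ring.inverse_unit, Ring.inverse_unit, Ring.inverse_unit]
  have hN : HasOpDet ((s + hankel (c * dp)) * ↑s⁻¹) := by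
    rw [add_mul, Units.mul_inv]
    exact hasOpDet_one_add (h.hankel_mul.mul_right _)
  refine ⟨hN, ?_⟩
  set N : Ell2 →L[ℂ] Ell2 := s + hankel (c * dp) with hNdef
  have e : ↑y⁻¹ * opM (c * dp) (c * dp * φ) * ↑m⁻¹ = (↑y⁻¹ * N) * ↑t⁻¹ := by
    rw [opM_mul_swap h.memLp_mul hφ hφφ ht, ← hm, opM, ← hs, ← hNdef]
    simp only [mul_assoc, Units.mul_inv, mul_one]
  -- rotate the factors so that `s` cancels
  have d1 : HasOpDet (↑t⁻¹ * (↑y⁻¹ * s)) := hasOpDet_rotate hEd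
  have d2 : HasOpDet (↑s⁻¹ * N) := hasOpDet_rotate hN
  have e2 : ↑t⁻¹ * (↑y⁻¹ * N) = (↑t⁻¹ * (↑y⁻¹ * ↑s)) * (↑s⁻¹ * N) := by
    simp only [mul_assoc, Units.mul_inv_cancel_left]
  have d3 : HasOpDet (↑t⁻¹ * (↑y⁻¹ * N)) := e2 ▸ d1.mul d2
  have d4 : HasOpDet ((↑y⁻¹ * N) * ↑t⁻¹) := by
    simpa [mul_assoc] using hasOpDet_unit_conj d3 t
  rw [e, ← opDet_rotate d4, e2, opDet_mul d1 d2, opDet_rotate hEd, opDet_rotate hN]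

/-- The formula for `E₁` when `T(φ)` is invertible. -/
theorem constE1_eq {ψ φ c d dp : 𝕋 → ℂ} (h : GoodSymbols c dp) (hψ : MemLp ψ ∞ haar)
    (hφ : MemLp φ ∞ haar) (hφφ : φ * tilde φ =ᵐ[haar] 1) (hTψ : IsUnit (toeplitz ψ))
    (hd : d =ᵐ[haar] dp * (tilde dp)⁻¹) (hTφ : IsUnit (toeplitz φ)) :
    IsUnit (opM 1 φ) ∧ E1Defined ψ φ c d dp ∧
      EDefined ψ (c * dp) ∧ EDefined (c * dp) ψ ∧ constE (c * dp) ψ ≠ 0 ∧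
      EDefined dp⁻¹ ψ⁻¹ ∧ EDefined (c * dp) φ ∧
      IsUnit (toeplitz (c * dp * φ)) ∧
      HasOpDet ((toeplitz (c * dp * φ) + hankel (c * dp)) * (toeplitz (c * dp * φ))⁻¹ʳ) ∧
      constE1 ψ φ c d dp =
        constE ψ (c * dp) / constE (c * dp) ψ * constE dp⁻¹ ψ⁻¹ * constE (c * dp) φ *
          opDet ((toeplitz (c * dp * φ) + hankel (c * dp)) * (toeplitz (c * dp * φ))⁻¹ʳ) := by
  have hM := isUnit_opM_one hφ hφφ hTφ
  have hψi := memLp_inv_of_isUnit_toeplitz hψ hTψ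
  have hTψi := isUnit_toeplitz_inv hψ hTψ
  have hTs : IsUnit (toeplitz (c * dp * φ)) := by
    rw [mul_comm (c * dp)]; exact h.preserves_mul.2 φ hφ hTφ
  obtain ⟨x, hx⟩ := id hTψ
  obtain ⟨y, hy⟩ := h.isUnit_toeplitz_mul
  obtain ⟨v, hv⟩ := id hTψi
  obtain ⟨w, hw⟩ := h.unit.isUnit_toeplitz
  obtain ⟨m, hm⟩ := id hM
  obtain ⟨t, ht⟩ := id hTφ
  obtain ⟨s, hs⟩ := id hTs
  obtain ⟨hE1, hE2⟩ := h.eDefined hψ hTψ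
  obtain ⟨-, hne, hP⟩ := constE_div_constE hE1 hE2 (h.preserves_mul.2 ψ hψ hTψ) hx hy
  obtain ⟨hN, hQ⟩ := h.opDet_opM hφ hφφ hy hm ht hs
  obtain ⟨-, -, hdet⟩ := opDet_opE1 h hψ hψi hφ hd hx hy hv hw hm
  refine ⟨hM, e1Defined_of_isUnit h hψ hφ hTψ hd hM, hE1, hE2, hne, h.eDefined_inv hψi hTψi,
    (h.eDefined hφ hTφ).2, hTs, hN, ?_⟩
  rw [constE1, hdet, hP, hQ, ← h.constE_inv hψi hw hv]
  ring

theorem isUnitHPlus_one : IsUnitHPlus 1 := by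
  have h : MemHPlus 1 :=
    ⟨memLp_one, fun n hn => by rw [fourierCoeff_one, if_neg hn.ne]⟩
  exact ⟨Eventually.of_forall fun _ => one_ne_zero, h, by simpa using h⟩

/-- The factor `d₊` may be dropped. -/
theorem GoodSymbols.one_right {c dp : 𝕋 → ℂ} (h : GoodSymbols c dp) : GoodSymbols c 1 where
  memLp := h.memLp
  preserves := h.preserves
  unit := isUnitHPlus_one
  hankel_left := h.hankel_left
  hankel_tilde_left := h.hankel_tilde_left
  hankel_right := by rw [hankel_one]; exact isTraceClass_zero
  hankel_inv_right := by rw [inv_one, hankel_one]; exact isTraceClass_zero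

/-- If `T(ψ)` factors as `f₋ f₊`, where `f₊` commutes with `w`, then the commutators of `w` with
`f₋ f₊` and of `w` with `f₋⁻¹ f₊⁻¹` have reciprocal determinants. -/
theorem opDet_commutator_mul_eq_one {w fm fp : (Ell2 →L[ℂ] Ell2)ˣ} (hcomm : w * fp = fp * w)
    (h1 : HasOpDet ((w * (fm * fp) * w⁻¹ * (fm * fp)⁻¹ : (Ell2 →L[ℂ] Ell2)ˣ) : Ell2 →L[ℂ] Ell2))
    (h2 : HasOpDet ((w * (fm⁻¹ * fp⁻¹) * w⁻¹ * (fm⁻¹ * fp⁻¹)⁻¹ : (Ell2 →L[ℂ] Ell2)ˣ) :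
      Ell2 →L[ℂ] Ell2)) :
    opDet ((w * (fm * fp) * w⁻¹ * (fm * fp)⁻¹ : (Ell2 →L[ℂ] Ell2)ˣ) : Ell2 →L[ℂ] Ell2) *
      opDet ((w * (fm⁻¹ * fp⁻¹) * w⁻¹ * (fm⁻¹ * fp⁻¹)⁻¹ : (Ell2 →L[ℂ] Ell2)ˣ) :
        Ell2 →L[ℂ] Ell2) = 1 := by
  have hc : Commute w⁻¹ fp := Commute.inv_left hcomm
  have c1 : fp * w⁻¹ * fp⁻¹ = w⁻¹ := by rw [← hc.eq, mul_inv_cancel_right]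
  have c2 : fp⁻¹ * w⁻¹ * fp = w⁻¹ := by rw [mul_assoc, hc.eq, inv_mul_cancel_left]
  have e1 : w * (fm * fp) * w⁻¹ * (fm * fp)⁻¹ = w * fm * w⁻¹ * fm⁻¹ := by
    calc _ = w * fm * (fp * w⁻¹ * fp⁻¹) * fm⁻¹ := by group
      _ = _ := by rw [c1]
  have e2 : w * (fm⁻¹ * fp⁻¹) * w⁻¹ * (fm⁻¹ * fp⁻¹)⁻¹ = w * fm⁻¹ * w⁻¹ * fm := by
    calc _ = w * fm⁻¹ * (fp⁻¹ * w⁻¹ * fp) * fm := by group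
      _ = _ := by rw [c2]
  rw [e1] at h1 ⊢
  rw [e2] at h2 ⊢
  have h3 := hasOpDet_unit_conj h2 fm
  rw [← opDet_unit_conj h2 fm, ← opDet_mul h1 h3, ← Units.val_mul, ← Units.val_mul,
    ← Units.val_mul, show w * fm * w⁻¹ * fm⁻¹ * (fm * (w * fm⁻¹ * w⁻¹ * fm) * fm⁻¹) = 1 by group,
    Units.val_one, opDet_one]

/-- With a factorization of `ψ`, the contributions of `d₊` to the factors of `E₁` that involve `ψ`
cancel. -/
theorem GoodSymbols.constE_ratio_eq {ψ c dp : 𝕋 → ℂ} (h : GoodSymbols c dp)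
    (hψ : MemLp ψ ∞ haar) (hTψ : IsUnit (toeplitz ψ)) (hf : HasBoundedFactorization ψ) :
    EDefined ψ c ∧ EDefined c ψ ∧ constE c ψ ≠ 0 ∧
      constE ψ (c * dp) / constE (c * dp) ψ * constE dp⁻¹ ψ⁻¹ = constE ψ c / constE c ψ := by
  have hψi := memLp_inv_of_isUnit_toeplitz hψ hTψ
  obtain ⟨gm, gp, hgm, hgp, hfac⟩ := hf
  obtain ⟨fm, hfm⟩ := hgm.isUnit_toeplitz
  obtain ⟨fp, hfp⟩ := hgp.isUnit_toeplitz
  obtain ⟨w, hw⟩ := h.unit.isUnit_toeplitz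
  obtain ⟨γ, hγ⟩ := h.isUnit_toeplitz_left
  have hx : ((fm * fp : (Ell2 →L[ℂ] Ell2)ˣ) : Ell2 →L[ℂ] Ell2) = toeplitz ψ := by
    rw [toeplitz_congr hfac, toeplitz_hMinus_mul hgm.2.1 hgp.2.1.1, Units.val_mul, hfm, hfp]
  have hv : ((fm⁻¹ * fp⁻¹ : (Ell2 →L[ℂ] Ell2)ˣ) : Ell2 →L[ℂ] Ell2) = toeplitz ψ⁻¹ := by
    have hfac' : ψ⁻¹ =ᵐ[haar] gm⁻¹ * gp⁻¹ := by
      filter_upwards [hfac] with x hx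
      simp only [Pi.inv_apply, Pi.mul_apply, hx, mul_inv]
    rw [toeplitz_congr hfac', toeplitz_hMinus_mul hgm.2.2 hgp.2.2.1, Units.val_mul]
    congr 1
    · exact Units.inv_eq_of_mul_eq_one_right (by rw [hfm, hgm.mul_toeplitz_inv])
    · exact Units.inv_eq_of_mul_eq_one_right (by rw [hfp, hgp.mul_toeplitz_inv])
  have hy : ((γ * w : (Ell2 →L[ℂ] Ell2)ˣ) : Ell2 →L[ℂ] Ell2) = toeplitz (c * dp) := by
    rw [h.toeplitz_mul_eq, Units.val_mul, hγ, hw]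
  have hcomm : w * fp = fp * w := by
    ext1
    rw [Units.val_mul, Units.val_mul, hw, hfp, ← toeplitz_mul_hPlus h.unit.2.1.1 hgp.2.1,
      ← toeplitz_mul_hPlus hgp.2.1.1 h.unit.2.1, mul_comm dp]
  obtain ⟨hE1, hE2⟩ := h.eDefined hψ hTψ
  obtain ⟨hE3, hE4⟩ := h.one_right.eDefined hψ hTψ
  rw [mul_one] at hE3 hE4
  obtain ⟨-, -, hP⟩ := constE_div_constE hE1 hE2 (h.preserves_mul.2 ψ hψ hTψ) hx hy
  obtain ⟨hR, hne, hRdet⟩ := constE_div_constE hE3 hE4 (h.preserves.2 ψ hψ hTψ) hx hγ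
  refine ⟨hE3, hE4, hne, ?_⟩
  have k1 := hasOpDet_commutator_symbols h hψ hw hx
  have k2 := hasOpDet_commutator_symbols h hψi hw hv
  rw [← hP, ← hRdet, h.constE_inv hψi hw hv]
  set x := fm * fp with hxdef
  have e : x * (γ * w)⁻¹ * x⁻¹ * (γ * w) =
      w⁻¹ * ((w * x * w⁻¹ * x⁻¹) * (x * γ⁻¹ * x⁻¹ * γ)) * w⁻¹⁻¹ := by group
  have k3 := k1.mul hR
  rw [e, Units.val_mul, Units.val_mul, Units.val_mul, opDet_unit_conj k3, opDet_mul k1 hR,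
    mul_right_comm, hxdef, opDet_commutator_mul_eq_one hcomm k1 k2, one_mul]

/-- With `φ = φ₋ φ₋~⁻¹`, the operator `T(φ₋)` conjugates `M(aφ, a) T(aφ)⁻¹` into
`M(a, a) T(a)⁻¹`. -/
theorem GoodSymbols.opDet_eq_constF {c dp φ : 𝕋 → ℂ} (h : GoodSymbols c dp)
    (hf : HasAntisymmetricBoundedFactorization φ) :
    IsUnit (toeplitz φ) ∧ HasOpDet (1 + (toeplitz (c * dp))⁻¹ʳ * hankel (c * dp)) ∧
    opDet ((toeplitz (c * dp * φ) + hankel (c * dp)) * (toeplitz (c * dp * φ))⁻¹ʳ) =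
      constF (c * dp) := by
  obtain ⟨g, hg, hfac⟩ := hf
  have hgi : IsUnitHPlus (tilde g⁻¹) := hg.inv.tilde
  have hfac' : φ =ᵐ[haar] g * tilde g⁻¹ := hfac
  set a := c * dp with hadef
  have ha : MemLp a ∞ haar := h.memLp_mul
  obtain ⟨f, hf⟩ := hg.isUnit_toeplitz
  obtain ⟨p, hp⟩ := hgi.isUnit_toeplitz
  obtain ⟨y, hy⟩ := h.isUnit_toeplitz_mul
  have hφ : IsUnit (toeplitz φ) := by
    rw [toeplitz_congr hfac', toeplitz_hMinus_mul hg.2.1 hgi.2.1.1]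
    exact hg.isUnit_toeplitz.mul hgi.isUnit_toeplitz
  have hT : toeplitz (a * φ) = ↑(f * y * p) := by
    have : a * φ =ᵐ[haar] g * (a * tilde g⁻¹) := by
      filter_upwards [hfac'] with x hx
      simp only [Pi.mul_apply, hx]
      ring
    rw [toeplitz_congr this, toeplitz_hMinus_mul hg.2.1 (ToeplitzHankel.memLp_mul ha hgi.2.1.1),
      toeplitz_mul_hPlus ha hgi.2.1, ← hf, ← hp, ← hy, Units.val_mul, Units.val_mul, mul_assoc]
  have hH : hankel a = f * hankel a * p := by
    have : a =ᵐ[haar] g * (a * g⁻¹) := by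
      filter_upwards [hg.1] with x hx
      simp only [Pi.mul_apply, Pi.inv_apply]
      field_simp
    conv_lhs => rw [hankel_congr this]
    rw [hankel_hMinus_mul hg.2.1 (ToeplitzHankel.memLp_mul ha hg.2.2.1), hankel_mul_hMinus ha hg.2.2, hf, hp,
      mul_assoc]
  have hF : HasOpDet (1 + (toeplitz a)⁻¹ʳ * hankel a) :=
    hasOpDet_one_add (h.hankel_mul.mul_left _)
  have eF : 1 + (toeplitz a)⁻¹ʳ * hankel a = ↑y⁻¹ * (y + hankel a) := by
    rw [← hy, Ring.inverse_unit, mul_add, Units.inv_mul]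
  refine ⟨hφ, hF, ?_⟩
  have e : (toeplitz (a * φ) + hankel a) * (toeplitz (a * φ))⁻¹ʳ =
      ↑(f * y) * (↑y⁻¹ * (y + hankel a)) * ↑(f * y)⁻¹ := by
    conv_lhs => rw [hH, hT, Ring.inverse_unit]
    simp only [Units.val_mul, mul_inv_rev, mul_assoc, Units.mul_inv_cancel_left, add_mul, mul_add]
  rw [eF] at hF
  rw [e, opDet_unit_conj hF, constF, eF]

end ToeplitzHankel

theorem theoremt6p2 (ψ φ c d dp : 𝕋 → ℂ)
    (hψ : MemLp ψ ∞ haar) (hφ : MemLp φ ∞ haar)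
    (hφφ : φ * tilde φ =ᵐ[haar] 1)
    (hTψ : IsUnit (toeplitz ψ))
    (hc_cont : Continuous c) (hc : MemB11 c) (hc0 : ∀ x, c x ≠ 0) (hcw : HasWindingNumber c 0)
    (hd : MemB11 d) (hddp : IsB11Factorization d dp) :
    -- (a)
    (IsUnit (opM 1 φ) → E1Defined ψ φ c d dp) ∧
    -- (b)
    (IsUnit (toeplitz φ) →
      IsUnit (opM 1 φ) ∧ E1Defined ψ φ c d dp ∧
      EDefined ψ (c * dp) ∧ EDefined (c * dp) ψ ∧ constE (c * dp) ψ ≠ 0 ∧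
      EDefined dp⁻¹ ψ⁻¹ ∧ EDefined (c * dp) φ ∧
      IsUnit (toeplitz (c * dp * φ)) ∧
      HasOpDet ((toeplitz (c * dp * φ) + hankel (c * dp)) * (toeplitz (c * dp * φ))⁻¹ʳ) ∧
      constE1 ψ φ c d dp =
        constE ψ (c * dp) / constE (c * dp) ψ * constE dp⁻¹ ψ⁻¹ * constE (c * dp) φ *
          opDet ((toeplitz (c * dp * φ) + hankel (c * dp)) * (toeplitz (c * dp * φ))⁻¹ʳ)) ∧
    -- (c)
    (HasAntisymmetricBoundedFactorization φ → HasBoundedFactorization ψ →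
      IsUnit (opM 1 φ) ∧ E1Defined ψ φ c d dp ∧
      EDefined ψ c ∧ EDefined c ψ ∧ constE c ψ ≠ 0 ∧ EDefined (c * dp) φ ∧
      HasOpDet (1 + (toeplitz (c * dp))⁻¹ʳ * hankel (c * dp)) ∧
      constE1 ψ φ c d dp =
        constE ψ c / constE c ψ * constE (c * dp) φ * constF (c * dp)) := by
  obtain ⟨hdp, hB, hBi, hfac⟩ := hddp
  have h := goodSymbols_of_besov hc_cont hc hcw hdp hB hBi
  have hb := fun hTφ => constE1_eq h hψ hφ hφφ hTψ hfac hTφ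
  refine ⟨fun hM => e1Defined_of_isUnit h hψ hφ hTψ hfac hM, hb, fun hanti hbdd => ?_⟩
  obtain ⟨hTφ, hF, hFdet⟩ := h.opDet_eq_constF hanti
  obtain ⟨hE3, hE4, hne, hratio⟩ := h.constE_ratio_eq hψ hTψ hbdd
  obtain ⟨hM, hE1, -, -, -, -, hEφ, -, -, hdet⟩ := hb hTφ
  exact ⟨hM, hE1, hE3, hE4, hne, hEφ, hF, by rw [hdet, hratio, hFdet]⟩
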